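/- Let $\mathfrak{s}$ be the Schrödinger Lie algebra over $\mathbb{C}$, with basis $e,h,f,p,q,z$, where $e,h,f$ span $\mathfrak{g}=\mathfrak{sl}_2$ ($[h,e]=2e$, $[h,f]=-2f$, $[e,f]=h$), $[e,p]=0$, $[h,p]=p$, $[f,p]=q$, $[e,q]=p$, $[h,q]=-q$, $[f,q]=0$, $[p,q]=z$, and $z$ is central. Let $\mathfrak{H}$ be the ideal spanned by $p,q,z$, and let $U=U(\mathfrak{s})$ be the universal enveloping algebra. An $\mathfrak{s}$-module is called a $\mathfrak{g}$-Harish-Chandra module if, as a $\mathfrak{g}$-module, it is a direct sum of simple finite-dimensional $\mathfrak{g}$-modules, each isomorphism class occurring with finite multiplicity. For $n\in\mathbb{Z}_{\ge 0}$ let $L(n)$ be the simple $\mathfrak{g}$-module of dimension $n+1$, also regarded as an $\mathfrak{s}$-module with trivial $\mathfrak{H}$-action. The module $L(n)$ is the minimal $\mathfrak{g}$-type of $V$ if $n$ is the smallest integer such that $V$ has a $\mathfrak{g}$-submodule isomorphic to $L(n)$. The central charge of $V$ is the scalar by which $z$ acts on $V$ (if it acts by a scalar). For $\lambda_1,\lambda_2\in\mathbb{C}$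 let $\Delta(\lambda_1,\lambda_2)$ be the Verma module, i.e. the $\mathfrak{s}$-module generated by a vector $v$ subject to the relations $ev=pv=0$, $hv=\lambda_1v$, $zv=\lambda_2v$. For an $\mathfrak{s}$-module $M$ let $$\mathrm{EA}(M)={}^{e}\bigl((U_{(f)}/U)\otimes_U M\bigr),$$ where $U_{(f)}$ is the localization of $U$ at the powers of $f$ and ${}^{e}N=\{m\in N:\dim\mathbb{C}[e]m<\infty\}$. For $n\in\mathbb{Z}$ and $\lambda_2\neq 0$ put $V(n,\lambda_2)=\mathrm{EA}(\Delta(n-1,\lambda_2))$ if $n\ge 0$ and $V(n,\lambda_2)=\mathrm{EA}(\Delta(n-2,\lambda_2))$ if $n\le 0$; for $n=0$ the two modules are isomorphic. **Theorem.** Let $V$ be a simple $\mathfrak{g}$-Harish-Chandra module for $\mathfrak{s}$. Then $V$ has a unique central charge $\lambda_2\in\mathbb{C}$ and a unique minimal $\mathfrak{g}$-type $L(n)$, $n\in\mathbb{Z}_{\ge 0}$, and: * if $\lambda_2\neq 0$, then $V\cong V(n,\lambda_2)\cong V(-n,\lambda_2)$; * if $\lambda_2=0$, then $V\cong L(n)$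 with the trivial $\mathfrak{H}$-action. In other words, the modules $V(n,\lambda_2)$, $n\in\mathbb{Z}_{\ge 0}$, $\lambda_2\in\mathbb{C}\setminus\{0\}$ (which are simple $\mathfrak{g}$-Harish-Chandra modules with central charge $\lambda_2$ and minimal $\mathfrak{g}$-type $L(n)$), together with the modules $L(n)$, $n\in\mathbb{Z}_{\ge 0}$, form a complete list of pairwise non-isomorphic simple $\mathfrak{g}$-Harish-Chandra modules for $\mathfrak{s}$. Moreover $V(n,\lambda_2)\cong V(-n,\lambda_2)$ for all $n\in\mathbb{Z}_{\ge 0}$ and $\lambda_2\neq 0$. -/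

import Mathlib

noncomputable section

/-- The Schrödinger Lie algebra over `ℂ`: an element is given by its coordinates in the basis
`e, h, f, p, q, z`. -/
@[ext]
structure Schrodinger where
  e : ℂ
  h : ℂ
  f : ℂ
  p : ℂ
  q : ℂ
  z : ℂ

namespace Schrodinger

instance : Zero Schrodinger := ⟨⟨0, 0, 0, 0, 0, 0⟩⟩

instance : Add Schrodinger :=
  ⟨fun x y => ⟨x.e + y.e, x.h + y.h, x.f + y.f, x.p + y.p, x.q + y.q, x.z + y.z⟩⟩

instance : Neg Schrodinger := ⟨fun x => ⟨-x.e, -x.h, -x.f, -x.p, -x.q, -x.z⟩⟩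

instance : SMul ℂ Schrodinger :=
  ⟨fun c x => ⟨c * x.e, c * x.h, c * x.f, c * x.p, c * x.q, c * x.z⟩⟩

/-- The bracket, determined by bilinearity, antisymmetry and the relations
`[h,e] = 2e`, `[h,f] = -2f`, `[e,f] = h`, `[e,p] = 0`, `[h,p] = p`, `[f,p] = q`,
`[e,q] = p`, `[h,q] = -q`, `[f,q] = 0`, `[p,q] = z`, and `z` is central. -/
instance : Bracket Schrodinger Schrodinger :=
  ⟨fun x y =>
    { e := 2 * (x.h * y.e - x.e * y.h)
      h := x.e * y.f - x.f * y.e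
      f := -2 * (x.h * y.f - x.f * y.h)
      p := (x.h * y.p - x.p * y.h) + (x.e * y.q - x.q * y.e)
      q := -(x.h * y.q - x.q * y.h) + (x.f * y.p - x.p * y.f)
      z := x.p * y.q - x.q * y.p }⟩

section simps
variable (x y : Schrodinger) (c : ℂ)
@[simp] lemma zero_e : (0 : Schrodinger).e = 0 := rfl
@[simp] lemma zero_h : (0 : Schrodinger).h = 0 := rfl
@[simp] lemma zero_f : (0 : Schrodinger).f = 0 := rfl
@[simp] lemma zero_p : (0 : Schrodinger).p = 0 := rfl
@[simp] lemma zero_q : (0 : Schrodinger).q = 0 := rfl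
@[simp] lemma zero_z : (0 : Schrodinger).z = 0 := rfl
@[simp] lemma add_e : (x + y).e = x.e + y.e := rfl
@[simp] lemma add_h : (x + y).h = x.h + y.h := rfl
@[simp] lemma add_f : (x + y).f = x.f + y.f := rfl
@[simp] lemma add_p : (x + y).p = x.p + y.p := rfl
@[simp] lemma add_q : (x + y).q = x.q + y.q := rfl
@[simp] lemma add_z : (x + y).z = x.z + y.z := rfl
@[simp] lemma neg_e : (-x).e = -x.e := rfl
@[simp] lemma neg_h : (-x).h = -x.h := rfl
@[simp] lemma neg_f : (-x).f = -x.f := rfl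
@[simp] lemma neg_p : (-x).p = -x.p := rfl
@[simp] lemma neg_q : (-x).q = -x.q := rfl
@[simp] lemma neg_z : (-x).z = -x.z := rfl
@[simp] lemma smul_e : (c • x).e = c * x.e := rfl
@[simp] lemma smul_h : (c • x).h = c * x.h := rfl
@[simp] lemma smul_f : (c • x).f = c * x.f := rfl
@[simp] lemma smul_p : (c • x).p = c * x.p := rfl
@[simp] lemma smul_q : (c • x).q = c * x.q := rfl
@[simp] lemma smul_z : (c • x).z = c * x.z := rfl
@[simp] lemma lie_e : ⁅x, y⁆.e = 2 * (x.h * y.e - x.e * y.h) := rfl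
@[simp] lemma lie_h : ⁅x, y⁆.h = x.e * y.f - x.f * y.e := rfl
@[simp] lemma lie_f : ⁅x, y⁆.f = -2 * (x.h * y.f - x.f * y.h) := rfl
@[simp] lemma lie_p : ⁅x, y⁆.p =
    (x.h * y.p - x.p * y.h) + (x.e * y.q - x.q * y.e) := rfl
@[simp] lemma lie_q : ⁅x, y⁆.q =
    -(x.h * y.q - x.q * y.h) + (x.f * y.p - x.p * y.f) := rfl
@[simp] lemma lie_z : ⁅x, y⁆.z = x.p * y.q - x.q * y.p := rfl
end simps

instance : AddCommGroup Schrodinger where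
  add_assoc x y z := by ext <;> simp [add_assoc]
  zero_add x := by ext <;> simp
  add_zero x := by ext <;> simp
  add_comm x y := by ext <;> simp [add_comm]
  neg_add_cancel x := by ext <;> simp
  nsmul := nsmulRec
  zsmul := zsmulRec

instance : Module ℂ Schrodinger where
  one_smul x := by ext <;> simp
  mul_smul a b x := by ext <;> simp [mul_assoc]
  smul_zero a := by ext <;> simp
  smul_add a x y := by ext <;> simp [mul_add]
  add_smul a b x := by ext <;> simp [add_mul]
  zero_smul x := by ext <;> simp

instance : LieRing Schrodinger where
  add_lie x y z := by ext <;> simp <;> ring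
  lie_add x y z := by ext <;> simp <;> ring
  lie_self x := by ext <;> simp <;> ring
  leibniz_lie x y z := by ext <;> simp <;> ring

instance : LieAlgebra ℂ Schrodinger where
  lie_smul c x y := by ext <;> simp <;> ring

/-! The basis of the Schrödinger algebra. -/

def E : Schrodinger := ⟨1, 0, 0, 0, 0, 0⟩
def H : Schrodinger := ⟨0, 1, 0, 0, 0, 0⟩
def F : Schrodinger := ⟨0, 0, 1, 0, 0, 0⟩
def P : Schrodinger := ⟨0, 0, 0, 1, 0, 0⟩
def Q : Schrodinger := ⟨0, 0, 0, 0, 1, 0⟩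
def Z : Schrodinger := ⟨0, 0, 0, 0, 0, 1⟩

/-- The Levi subalgebra `sl₂`, spanned by `e, h, f`. -/
def sl2 : LieSubalgebra ℂ Schrodinger where
  carrier := {x | x.p = 0 ∧ x.q = 0 ∧ x.z = 0}
  add_mem' := by rintro x y ⟨h1, h2, h3⟩ ⟨h4, h5, h6⟩; simp [*]
  zero_mem' := by simp
  smul_mem' := by rintro c x ⟨h1, h2, h3⟩; simp [*]
  lie_mem' := by rintro x y ⟨h1, h2, h3⟩ ⟨h4, h5, h6⟩; simp [*]

/-! ### `sl₂`-Harish-Chandra modules -/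

section HarishChandra

variable (V : Type*) [AddCommGroup V] [Module ℂ V] [LieRingModule Schrodinger V]
  [LieModule ℂ Schrodinger V]

/-- `V` is a `sl₂`-Harish-Chandra module: as a `sl₂`-module, `V` is the (internal) direct sum of a
family of simple finite-dimensional submodules, in which every isomorphism class occurs only
finitely many times. -/
def IsHarishChandra : Prop :=
  ∃ S : Set (LieSubmodule ℂ sl2 V),
    (∀ W ∈ S, LieModule.IsIrreducible ℂ sl2 W ∧ FiniteDimensional ℂ W) ∧
    sSupIndep S ∧ sSup S = ⊤ ∧
    ∀ W ∈ S, {W' ∈ S | Nonempty (W' ≃ₗ⁅ℂ, sl2⁆ W)}.Finite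

/-- `V` has central charge `c`: the central element `z` acts as the scalar `c`. -/
def HasCentralCharge (c : ℂ) : Prop := ∀ v : V, ⁅Z, v⁆ = c • v

end HarishChandra

/-! ### The simple modules `L(n)` -/

/-- The underlying space `ℂ^(n+1)` of the simple module `L(n)`. -/
def L (n : ℕ) : Type := Fin (n + 1) → ℂ

namespace L

variable (n : ℕ)

instance : AddCommGroup (L n) := inferInstanceAs (AddCommGroup (Fin (n + 1) → ℂ))
instance : Module ℂ (L n) := inferInstanceAs (Module ℂ (Fin (n + 1) → ℂ))

variable {n}

/-- The `k`-th coordinate of `v`, and `0` if `k > n`. -/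
def coord (v : L n) (k : ℕ) : ℂ := if hk : k < n + 1 then v ⟨k, hk⟩ else 0

/-- The action of the Schrödinger algebra on `L(n)`. In the standard basis `v₀, …, vₙ`,
`h vᵢ = (n - 2i) vᵢ`, `e vᵢ = (n - i + 1) vᵢ₋₁`, `f vᵢ = (i + 1) vᵢ₊₁`
(with `v₋₁ = vₙ₊₁ = 0`), and `p`, `q`, `z` act by zero. -/
instance : Bracket Schrodinger (L n) :=
  ⟨fun x v i => x.h * (n - 2 * (i : ℕ)) * v.coord i + x.e * (n - (i : ℕ)) * v.coord (i + 1)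
    + x.f * (i : ℕ) * v.coord (i - 1)⟩

@[ext] lemma ext {v w : L n} (h : ∀ k < n + 1, v.coord k = w.coord k) : v = w := by
  funext i
  have := h i i.2
  have hi : (i : ℕ) < n + 1 := i.2
  rwa [coord, coord, dif_pos hi, dif_pos hi] at this

@[simp] lemma coord_add (v w : L n) (k : ℕ) : (v + w).coord k = v.coord k + w.coord k := by
  unfold coord
  split_ifs
  · rfl
  · simp

@[simp] lemma coord_smul (c : ℂ) (v : L n) (k : ℕ) : (c • v).coord k = c * v.coord k := by
  unfold coord
  split_ifs
  · rfl
  · simp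

lemma coord_lie (x : Schrodinger) (v : L n) (k : ℕ) (hk : k < n + 1) :
    (⁅x, v⁆ : L n).coord k = x.h * (n - 2 * k) * v.coord k + x.e * (n - k) * v.coord (k + 1)
      + x.f * k * v.coord (k - 1) := by
  rw [coord, dif_pos hk]
  rfl

lemma coord_lie_succ (x : Schrodinger) (v : L n) (k : ℕ) (hk : k < n + 1) :
    (n - k : ℂ) * (⁅x, v⁆ : L n).coord (k + 1) =
      (n - k : ℂ) * (x.h * (n - 2 * (k + 1)) * v.coord (k + 1)
        + x.e * (n - (k + 1)) * v.coord (k + 2) + x.f * (k + 1) * v.coord k) := by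
  by_cases h : k = n
  · simp [h]
  · rw [coord_lie x v (k + 1) (by omega)]
    simp

lemma coord_lie_pred (x : Schrodinger) (v : L n) (k : ℕ) (hk : k < n + 1) :
    (k : ℂ) * (⁅x, v⁆ : L n).coord (k - 1) =
      k * (x.h * (n - 2 * (k - 1)) * v.coord (k - 1) + x.e * (n - (k - 1)) * v.coord k
        + x.f * (k - 1) * v.coord (k - 2)) := by
  cases k with
  | zero => simp
  | succ m =>
    rw [coord_lie x v (m + 1 - 1) (by omega)]
    simp

instance : LieRingModule Schrodinger (L n) where
  add_lie x y v := by
    ext k hk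
    simp only [coord_add, coord_lie _ _ _ hk, add_e, add_h, add_f]
    ring
  lie_add x v w := by
    ext k hk
    simp only [coord_add, coord_lie _ _ _ hk]
    ring
  leibniz_lie x y v := by
    ext k hk
    simp only [coord_add, coord_lie _ _ _ hk]
    have h1 := coord_lie_succ x v k hk
    have h2 := coord_lie_pred x v k hk
    have h3 := coord_lie_succ y v k hk
    have h4 := coord_lie_pred y v k hk
    simp only [lie_e, lie_h, lie_f]
    linear_combination x.e * h3 + x.f * h4 - y.e * h1 - y.f * h2

instance : LieModule ℂ Schrodinger (L n) where
  smul_lie c x v := by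
    ext k hk
    simp only [coord_smul, coord_lie _ _ _ hk, smul_e, smul_h, smul_f]
    ring
  lie_smul c x v := by
    ext k hk
    simp only [coord_smul, coord_lie _ _ _ hk]
    ring

end L

/-- `L(n)` is a `sl₂`-type of `V`, i.e. `V` has a `sl₂`-submodule isomorphic to `L(n)`. -/
def IsType (V : Type*) [AddCommGroup V] [Module ℂ V] [LieRingModule Schrodinger V]
    [LieModule ℂ Schrodinger V] (n : ℕ) : Prop :=
  ∃ W : LieSubmodule ℂ sl2 V, Nonempty (W ≃ₗ⁅ℂ, sl2⁆ L n)

/-- `L(n)` is the minimal `sl₂`-type of `V`. -/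
def IsMinimalType (V : Type*) [AddCommGroup V] [Module ℂ V] [LieRingModule Schrodinger V]
    [LieModule ℂ Schrodinger V] (n : ℕ) : Prop :=
  IsLeast {m | IsType V m} n

/-! ### The enveloping algebra and locally ad-nilpotent elements -/

/-- The universal enveloping algebra of the Schrödinger algebra. -/
abbrev U : Type := UniversalEnvelopingAlgebra ℂ Schrodinger

/-- The canonical map from the Schrödinger algebra to its enveloping algebra. -/
def toU (x : Schrodinger) : U := UniversalEnvelopingAlgebra.ι ℂ x

lemma toU_add (x y : Schrodinger) : toU (x + y) = toU x + toU y :=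
  map_add (UniversalEnvelopingAlgebra.ι ℂ) x y

lemma toU_smul (c : ℂ) (x : Schrodinger) : toU (c • x) = c • toU x :=
  map_smul (UniversalEnvelopingAlgebra.ι ℂ) c x

lemma toU_lie (x y : Schrodinger) : toU ⁅x, y⁆ = toU x * toU y - toU y * toU x := by
  let _ : LieRing U := LieRing.ofAssociativeRing
  exact LieHom.map_lie (UniversalEnvelopingAlgebra.ι ℂ) x y

/-- The linear map `u ↦ a u - u a` on the enveloping algebra. -/
def adU (a : U) : U →ₗ[ℂ] U := LinearMap.mulLeft ℂ a - LinearMap.mulRight ℂ a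

lemma adU_apply (a u : U) : adU a u = a * u - u * a := rfl

lemma adU_pow_mul (a : U) (n A B : ℕ) (hn : A + B ≤ n) (u v : U)
    (hu : (adU a ^ A) u = 0) (hv : (adU a ^ B) v = 0) : (adU a ^ n) (u * v) = 0 := by
  induction n generalizing A B u v with
  | zero =>
    obtain rfl : A = 0 := by omega
    have : u = 0 := by simpa using hu
    simp [this]
  | succ n ih =>
    rcases A with _ | A
    · have : u = 0 := by simpa using hu
      simp [this]
    rcases B with _ | B
    · have : v = 0 := by simpa using hv
      simp [this]
    have h : adU a (u * v) = adU a u * v + u * adU a v := by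
      simp only [adU_apply]; noncomm_ring
    rw [pow_succ, Module.End.mul_apply, h, map_add]
    rw [pow_succ, Module.End.mul_apply] at hu hv
    rw [ih A (B + 1) (by omega) _ _ hu (by rw [pow_succ, Module.End.mul_apply]; exact hv),
      ih (A + 1) B (by omega) _ _ (by rw [pow_succ, Module.End.mul_apply]; exact hu) hv, add_zero]

lemma adU_pow_of_le (a : U) {m n : ℕ} (h : m ≤ n) {u : U} (hu : (adU a ^ m) u = 0) :
    (adU a ^ n) u = 0 := by
  obtain ⟨k, rfl⟩ := Nat.exists_eq_add_of_le h
  rw [add_comm, pow_add, Module.End.mul_apply, hu, map_zero]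

/-- The subalgebra of the elements on which `ad a` is nilpotent. -/
def adNilSubalgebra (a : U) : Subalgebra ℂ U where
  carrier := {u | ∃ n, (adU a ^ n) u = 0}
  mul_mem' := by
    rintro u v ⟨A, hA⟩ ⟨B, hB⟩
    exact ⟨A + B, adU_pow_mul a _ A B le_rfl u v hA hB⟩
  add_mem' := by
    rintro u v ⟨A, hA⟩ ⟨B, hB⟩
    refine ⟨A + B, ?_⟩
    rw [map_add, adU_pow_of_le a (Nat.le_add_right A B) hA,
      adU_pow_of_le a (Nat.le_add_left B A) hB, add_zero]
  algebraMap_mem' c := ⟨1, by simp [adU_apply, Algebra.commutes]⟩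

lemma adNilSubalgebra_eq_top (a : U) (h : ∀ x, toU x ∈ adNilSubalgebra a) :
    adNilSubalgebra a = ⊤ := by
  have hind : ∀ t : TensorAlgebra ℂ Schrodinger,
      UniversalEnvelopingAlgebra.mkAlgHom ℂ Schrodinger t ∈ adNilSubalgebra a := by
    intro t
    induction t using TensorAlgebra.induction with
    | algebraMap r =>
      rw [AlgHom.commutes]
      exact Subalgebra.algebraMap_mem _ r
    | ι x => exact h x
    | mul u v hu hv => rw [map_mul]; exact Subalgebra.mul_mem _ hu hv
    | add u v hu hv => rw [map_add]; exact Subalgebra.add_mem _ hu hv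
  refine Algebra.eq_top_iff.2 fun u => ?_
  obtain ⟨t, rfl⟩ : ∃ t, UniversalEnvelopingAlgebra.mkAlgHom ℂ Schrodinger t = u :=
    RingCon.mkₐ_surjective _ u
  exact hind t

lemma adU_toU (x y : Schrodinger) : adU (toU x) (toU y) = toU ⁅x, y⁆ := by
  rw [adU_apply, toU_lie]

lemma toU_zero : toU 0 = 0 := map_zero (UniversalEnvelopingAlgebra.ι ℂ)

lemma adE_nilpotent (u : U) : ∃ n, (adU (toU E) ^ n) u = 0 := by
  have := adNilSubalgebra_eq_top (toU E) (fun x => ⟨3, by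
    simp only [pow_succ, pow_zero, one_mul, Module.End.mul_apply, adU_toU]
    rw [← toU_zero]
    congr 1
    ext <;> simp [E]⟩)
  have hu : u ∈ adNilSubalgebra (toU E) := this ▸ Algebra.mem_top
  exact hu

lemma adF_nilpotent (u : U) : ∃ n, (adU (toU F) ^ n) u = 0 := by
  have := adNilSubalgebra_eq_top (toU F) (fun x => ⟨3, by
    simp only [pow_succ, pow_zero, one_mul, Module.End.mul_apply, adU_toU]
    rw [← toU_zero]
    congr 1
    ext <;> simp [F]⟩)
  have hu : u ∈ adNilSubalgebra (toU F) := this ▸ Algebra.mem_top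
  exact hu

lemma pow_mul_eq (a u : U) (n : ℕ) :
    a ^ n * u = ∑ m ∈ Finset.HasAntidiagonal.antidiagonal n, n.choose m.1 • ((adU a ^ m.1) u * a ^ m.2) := by
  have hc : Commute (adU a) (LinearMap.mulRight ℂ a) := by
    have := LinearMap.commute_mulLeft_right (R := ℂ) a a
    exact this.sub_left (Commute.refl _)
  have h := hc.add_pow' n
  have h2 : adU a + LinearMap.mulRight ℂ a = LinearMap.mulLeft ℂ a := sub_add_cancel _ _
  rw [h2, LinearMap.pow_mulLeft] at h
  have h3 := congrArg (fun g : U →ₗ[ℂ] U => g u) h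
  simp only [LinearMap.mulLeft_apply, LinearMap.sum_apply, LinearMap.smul_apply] at h3
  rw [h3]
  refine Finset.sum_congr rfl fun m _ => ?_
  rw [((hc.pow_pow m.1 m.2).eq), Module.End.mul_apply, LinearMap.pow_mulRight,
    LinearMap.mulRight_apply]

/-! ### Localization by `f` and the Enright–Arkhipov completion -/

/-- The multiplicative set `{1, f, f², …}` in the enveloping algebra. -/
def powF : Submonoid U := Submonoid.powers (toU F)

lemma ore_cancel (r : U) (k : ℕ) (h : r * toU F ^ k = 0) : ∃ n, toU F ^ n * r = 0 := by
  obtain ⟨N, hN⟩ := adF_nilpotent r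
  refine ⟨N + k, ?_⟩
  rw [pow_mul_eq]
  refine Finset.sum_eq_zero fun m hm => ?_
  have hm' : m.1 + m.2 = N + k := Finset.HasAntidiagonal.mem_antidiagonal.1 hm
  by_cases h1 : N ≤ m.1
  · rw [adU_pow_of_le _ h1 hN, zero_mul, smul_zero]
  · have hcomm : ∀ i : ℕ, (adU (toU F) ^ i) r * toU F ^ k = (adU (toU F) ^ i) (r * toU F ^ k) := by
      intro i
      induction i with
      | zero => simp
      | succ i ih =>
        rw [pow_succ', Module.End.mul_apply, Module.End.mul_apply, ← ih, adU_apply, adU_apply,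
          sub_mul, mul_assoc, mul_assoc, mul_assoc, ← pow_succ, ← pow_succ']
    obtain ⟨j, hj⟩ := Nat.exists_eq_add_of_le (show k ≤ m.2 by omega)
    rw [hj, pow_add, ← mul_assoc, hcomm, h, map_zero, zero_mul, smul_zero]

lemma ore_exists (r : U) (s : powF) : ∃ (r' : U) (s' : powF), s' * r = r' * s := by
  obtain ⟨k, hk⟩ := s.2
  have hk' : toU F ^ k = (s : U) := hk
  obtain ⟨N, hN⟩ := adF_nilpotent r
  refine ⟨∑ m ∈ Finset.HasAntidiagonal.antidiagonal (N + k),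
    (N + k).choose m.1 • ((adU (toU F) ^ m.1) r * toU F ^ (m.2 - k)),
    ⟨toU F ^ (N + k), N + k, rfl⟩, ?_⟩
  change toU F ^ (N + k) * r = _
  rw [pow_mul_eq, Finset.sum_mul, ← hk']
  refine Finset.sum_congr rfl fun m hm => ?_
  have hm' : m.1 + m.2 = N + k := Finset.HasAntidiagonal.mem_antidiagonal.1 hm
  by_cases h1 : N ≤ m.1
  · rw [adU_pow_of_le _ h1 hN]; simp
  · rw [smul_mul_assoc, mul_assoc, ← pow_add, Nat.sub_add_cancel (by omega)]

/-- The multiplicative set generated by `f` satisfies the Ore conditions. -/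
instance : OreLocalization.OreSet powF where
  ore_right_cancel r₁ r₂ s h := by
    obtain ⟨k, hk⟩ := s.2
    obtain ⟨n, hn⟩ := ore_cancel (r₁ - r₂) k (by
      have hk' : toU F ^ k = (s : U) := hk
      rw [hk', sub_mul, h, sub_self])
    refine ⟨⟨toU F ^ n, n, rfl⟩, ?_⟩
    rwa [mul_sub, sub_eq_zero] at hn
  oreNum r s := (ore_exists r s).choose
  oreDenom r s := (ore_exists r s).choose_spec.choose
  ore_eq r s := (ore_exists r s).choose_spec.choose_spec

section EA

variable (M : Type*) [AddCommGroup M] [Module U M] [Module ℂ M] [IsScalarTower ℂ U M]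

/-- The localization `U_(f) ⊗_U M` of `M` by the powers of `f`, realized as the module of left
fractions `f⁻ᵏ m`. -/
abbrev Localized : Type _ := OreLocalization powF M

/-- The canonical map `j : M → U_(f) ⊗_U M`, `m ↦ 1 ⊗ m`. -/
def canonicalMap : M →ₗ[U] Localized M where
  toFun m := OreLocalization.oreDiv m 1
  map_add' _ _ := OreLocalization.add_oreDiv.symm
  map_smul' u m := (OreLocalization.smul_oreDiv_one u m).symm

/-- The module `S_f ⊗_U M = (U_(f) ⊗_U M) / j(M)`, where `S_f = U_(f) / U`. -/
abbrev Twist : Type _ := Localized M ⧸ LinearMap.range (canonicalMap M)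

/-- The submodule of all `m` on which `e` acts locally finitely, i.e. `dim ℂ[e] m < ∞`. -/
def eFinite : Submodule U M where
  carrier := {m | FiniteDimensional ℂ (Submodule.span ℂ (Set.range fun k : ℕ => toU E ^ k • m))}
  add_mem' := by
    intro m n hm hn
    have hm' : FiniteDimensional ℂ
        (Submodule.span ℂ (Set.range fun k : ℕ => toU E ^ k • m)) := hm
    have hn' : FiniteDimensional ℂ
        (Submodule.span ℂ (Set.range fun k : ℕ => toU E ^ k • n)) := hn
    refine Submodule.finiteDimensional_of_le
      (S₂ := Submodule.span ℂ (Set.range fun k : ℕ => toU E ^ k • m) ⊔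
        Submodule.span ℂ (Set.range fun k : ℕ => toU E ^ k • n)) ?_
    rw [Submodule.span_le]
    rintro _ ⟨k, rfl⟩
    simp only [smul_add]
    exact Submodule.add_mem_sup (Submodule.subset_span ⟨k, rfl⟩) (Submodule.subset_span ⟨k, rfl⟩)
  zero_mem' := by
    refine Submodule.finiteDimensional_of_le (S₂ := (⊥ : Submodule ℂ M)) ?_
    rw [Submodule.span_le]
    rintro _ ⟨k, rfl⟩
    simp
  smul_mem' := by
    intro u m hm
    have hm' : FiniteDimensional ℂ
        (Submodule.span ℂ (Set.range fun k : ℕ => toU E ^ k • m)) := hm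
    obtain ⟨N, hN⟩ := adE_nilpotent u
    refine Submodule.finiteDimensional_of_le
      (S₂ := ⨆ i : Fin N, (Submodule.span ℂ (Set.range fun k : ℕ => toU E ^ k • m)).map
        (Algebra.lsmul ℂ ℂ M ((adU (toU E) ^ (i : ℕ)) u))) ?_
    rw [Submodule.span_le]
    rintro _ ⟨k, rfl⟩
    simp only [SetLike.mem_coe]
    rw [← mul_smul, pow_mul_eq, Finset.sum_smul]
    refine Submodule.sum_mem _ fun x _ => ?_
    by_cases h1 : N ≤ x.1
    · rw [adU_pow_of_le _ h1 hN, zero_mul, smul_zero, zero_smul]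
      exact Submodule.zero_mem _
    · rw [smul_assoc]
      refine Submodule.smul_of_tower_mem _ _ ?_
      refine Submodule.mem_iSup_of_mem (⟨x.1, by omega⟩ : Fin N) ?_
      refine ⟨toU E ^ x.2 • m, Submodule.subset_span ⟨x.2, rfl⟩, ?_⟩
      simp [mul_smul]

/-- The Enright–Arkhipov completion of `M`: the `e`-locally finite part of `S_f ⊗_U M`. -/
def EA : Type _ := eFinite (Twist M)

instance : AddCommGroup (EA M) := inferInstanceAs (AddCommGroup (eFinite (Twist M)))
instance : Module U (EA M) := inferInstanceAs (Module U (eFinite (Twist M)))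
instance : Module ℂ (EA M) := inferInstanceAs (Module ℂ (eFinite (Twist M)))
instance : IsScalarTower ℂ U (EA M) := inferInstanceAs (IsScalarTower ℂ U (eFinite (Twist M)))

instance : LieRingModule Schrodinger (EA M) where
  bracket x m := toU x • m
  add_lie x y m := by
    change toU (x + y) • m = toU x • m + toU y • m
    rw [toU_add, add_smul]
  lie_add x m n := smul_add (toU x) m n
  leibniz_lie x y m := by
    change toU x • toU y • m = toU ⁅x, y⁆ • m + toU y • toU x • m
    rw [toU_lie, sub_smul, mul_smul, mul_smul, sub_add_cancel]

instance : LieModule ℂ Schrodinger (EA M) where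
  smul_lie c x m := by
    change toU (c • x) • m = c • toU x • m
    rw [toU_smul, smul_assoc]
  lie_smul c x m := by
    change toU x • c • m = c • toU x • m
    exact smul_algebra_smul_comm c (toU x) m

end EA

/-! ### Verma modules and the modules `V(n, c)` -/

/-- The left ideal generated by `e`, `p`, `h - a`, `z - c`. -/
def vermaIdeal (a c : ℂ) : Submodule U U :=
  Submodule.span U
    {toU E, toU P, toU H - algebraMap ℂ U a, toU Z - algebraMap ℂ U c}

/-- The Verma module `Δ(a, c)`, the module generated by a vector `v` subject to the relations
`e v = p v = 0`, `h v = a v`, `z v = c v`. It is induced from the one-dimensional module over the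
subalgebra spanned by `h, z, e, p` on which `h` and `z` act as `a` and `c`, and `e` and `p`
by zero. -/
abbrev Verma (a c : ℂ) : Type := U ⧸ vermaIdeal a c

/-- The module `V(n, c)`: the completion of `Δ(n - 1, c)` if `n ≥ 0` and of `Δ(n - 2, c)`
if `n < 0`. -/
abbrev V (n : ℤ) (c : ℂ) : Type := EA (Verma (if 0 ≤ n then n - 1 else n - 2) c)

end Schrodinger

end

universe u

noncomputable section

set_option linter.unusedSectionVars false

namespace Schrodinger

/-! As an `sl₂`-module the span of `p`, `q` (modulo `z`) is `L(1)`, and `L(1) ⊗ L(μ)` has the types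
`μ + 1` and `μ - 1`. Accordingly, on singular vectors of weight `μ` there are two operators: `p`
raises the weight by one and `lower μ = μ q - p f` lowers it by one. They satisfy `lower (μ + 1) p =
p (lower μ) - (μ + 1) z`.

In a Harish-Chandra module of central charge `c`, a singular vector `v` of minimal weight `n` is
killed by the lowering operator, since weight `n - 1` does not occur
(`IsHarishChandra.exists_isBottom`). The commutation rule then gives `lower (pⁱ v) = -c i (2n + i +
1) / 2 • pⁱ⁻¹ v`, and the whole algebra acts on the vectors `fʲ pⁱ v` through constants that depend
only on `n` and `c`. If `c ≠ 0`, the lowering coefficients with `i > 0` are nonzero. Hence the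
vectors with `j ≤ n + i` are independent, their span is simple (`IsBottom.isIrreducible`), and
modules with the same `n` and `c` are isomorphic (`IsBottom.nonempty_equiv`). If `c = 0`, then `p v`
is again killed by lowering; were it nonzero it would generate a module whose types are all at least
`n + 1`. So `p v = 0` in a simple module, and the module is `L(n)` (`IsBottom.nonempty_equiv_L`).

It remains to place the completions in this family. The localized Verma module has the basis `fⁱ qʲ
v` with `i ∈ ℤ`, `j ≥ 0`, and the quotient keeps only `i < 0`, so `f` becomes locally nilpotent. A
bottom vector of weight `n` is written down explicitly for both highest weights, `n - 1` and `-n -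
2`. Singular vectors of a given weight are unique up to scalars, because `e` imposes a two-term
recursion on coefficients (`EA.singular_unique`). With complete reducibility over `sl₂`
(`exists_sum_pw_F`) this forces the bottom vector to generate (`IsBottom.span_eq_top_of_singular`).
So `V(n, c)` and `V(-n, c)` are both the module attached to `(n, c)`. -/

lemma lie_E_F : ⁅E, F⁆ = H := by ext <;> simp [E, F, H]
lemma lie_H_E : ⁅H, E⁆ = (2 : ℂ) • E := by ext <;> simp [E, H]
lemma lie_H_F : ⁅H, F⁆ = (-2 : ℂ) • F := by ext <;> simp [F, H]
lemma lie_E_P : ⁅E, P⁆ = 0 := by ext <;> simp [E, P]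
lemma lie_H_P : ⁅H, P⁆ = P := by ext <;> simp [H, P]
lemma lie_F_P : ⁅F, P⁆ = Q := by ext <;> simp [F, P, Q]
lemma lie_E_Q : ⁅E, Q⁆ = P := by ext <;> simp [E, P, Q]
lemma lie_H_Q : ⁅H, Q⁆ = -Q := by ext <;> simp [H, Q]
lemma lie_F_Q : ⁅F, Q⁆ = 0 := by ext <;> simp [F, Q]
lemma lie_P_Q : ⁅P, Q⁆ = Z := by ext <;> simp [P, Q, Z]
lemma lie_Z (x : Schrodinger) : ⁅x, Z⁆ = 0 := by ext <;> simp [Z]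

lemma eq_sum (x : Schrodinger) :
    x = x.e • E + x.h • H + x.f • F + x.p • P + x.q • Q + x.z • Z := by
  ext <;> simp [E, H, F, P, Q, Z]

/-! ### Eigenvectors in invariant subspaces -/

/-- If `A` preserves `X` and a sum of eigenvectors of `A` with distinct eigenvalues is in `X`,
then so are the summands. -/
lemma mem_of_sum_mem {M ι : Type*} [AddCommGroup M] [Module ℂ M] {A : Module.End ℂ M}
    {X : Submodule ℂ M} (hX : ∀ x ∈ X, A x ∈ X) {l : ι → ℂ} (s : Finset ι) (hl : Set.InjOn l s) :
    ∀ y : ι → M, (∀ i ∈ s, A (y i) = l i • y i) → ∑ i ∈ s, y i ∈ X → ∀ i ∈ s, y i ∈ X := by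
  classical
  induction s using Finset.induction_on with
  | empty => simp
  | insert a s ha ih =>
    intro y hy hsum
    have hs : ∀ i ∈ s, y i ∈ X := by
      -- The operator `A - l a` kills the term `y a` and scales `y i` by `l i - l a`, so it shortens
      -- the sum.
      have key : ∀ i ∈ s, (l i - l a) • y i ∈ X := by
        refine ih (hl.mono (by simp)) (fun i => (l i - l a) • y i) (fun i hi => ?_) ?_
        · rw [map_smul, hy i (Finset.mem_insert_of_mem hi), smul_comm]
        · have h1 := X.sub_mem (hX _ hsum) (X.smul_mem (l a) hsum)
          rw [Finset.sum_insert ha, map_add, map_sum, hy a (Finset.mem_insert_self a s), smul_add,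
            add_sub_add_left_eq_sub, Finset.smul_sum, ← Finset.sum_sub_distrib] at h1
          refine (congrArg (· ∈ X) (Finset.sum_congr rfl fun i hi => ?_)).mp h1
          rw [hy i (Finset.mem_insert_of_mem hi), sub_smul]
      intro i hi
      have hne : l i - l a ≠ 0 := by
        rw [sub_ne_zero]
        intro h
        have := hl (by simp [hi]) (by simp) h
        exact ha (this ▸ hi)
      exact (X.smul_mem_iff hne).1 (key i hi)
    intro i hi
    rcases Finset.mem_insert.1 hi with rfl | hi
    · rw [Finset.sum_insert ha] at hsum
      exact (X.add_mem_iff_left (X.sum_mem hs)).1 hsum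
    · exact hs i hi

/-- A nonzero subspace, invariant under an operator that is diagonal on a spanning family with
distinct eigenvalues, contains a nonzero member of the family. -/
lemma exists_mem_of_eigenfamily {M ι : Type*} [AddCommGroup M] [Module ℂ M] {A : Module.End ℂ M}
    {X : Submodule ℂ M} (hX : ∀ x ∈ X, A x ∈ X) {l : ι → ℂ} (hl : Function.Injective l)
    {b : ι → M} (hb : ∀ i, A (b i) = l i • b i) {x : M} (hx : x ∈ X) (hx0 : x ≠ 0)
    (hspan : x ∈ Submodule.span ℂ (Set.range b)) : ∃ i, b i ≠ 0 ∧ b i ∈ X := by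
  obtain ⟨a, rfl⟩ := Finsupp.mem_span_range_iff_exists_finsupp.1 hspan
  have h := mem_of_sum_mem hX a.support hl.injOn (fun i => a i • b i)
    (fun i _ => by rw [map_smul, hb, smul_comm]) hx
  obtain ⟨i, hi, hne⟩ := Finset.exists_ne_zero_of_sum_ne_zero hx0
  refine ⟨i, right_ne_zero_of_smul hne, (X.smul_mem_iff (left_ne_zero_of_smul hne)).1 (h i hi)⟩

/-! ### Singular vectors, raising and lowering -/

section Rep

variable {M : Type*} [AddCommGroup M] [Module ℂ M] [LieRingModule Schrodinger M]
  [LieModule ℂ Schrodinger M]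

/-- The `j`-th power of the action of `x`. -/
def pw (x : Schrodinger) (j : ℕ) : Module.End ℂ M := LieModule.toEnd ℂ Schrodinger M x ^ j

@[simp] lemma pw_zero (x : Schrodinger) (m : M) : pw x 0 m = m := rfl

lemma pw_succ (x : Schrodinger) (j : ℕ) (m : M) : pw x (j + 1) m = ⁅x, pw x j m⁆ := by
  rw [pw, pow_succ']; rfl

lemma pw_succ' (x : Schrodinger) (j : ℕ) (m : M) : pw x (j + 1) m = pw x j ⁅x, m⁆ := by
  rw [pw, pow_succ]; rfl

lemma pw_add (x : Schrodinger) (i j : ℕ) (m : M) : pw x (i + j) m = pw x i (pw x j m) := by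
  rw [pw, pow_add]; rfl

lemma pw_eq_zero_of_le {x : Schrodinger} {i j : ℕ} (h : i ≤ j) {m : M} (hm : pw x i m = 0) :
    pw x j m = 0 := by
  obtain ⟨k, rfl⟩ := Nat.exists_eq_add_of_le h
  rw [add_comm, pw_add, hm, map_zero]

lemma E_F (x : M) : ⁅E, ⁅F, x⁆⁆ = ⁅F, ⁅E, x⁆⁆ + ⁅H, x⁆ := by
  rw [leibniz_lie, lie_E_F, add_comm]
lemma H_E (x : M) : ⁅H, ⁅E, x⁆⁆ = ⁅E, ⁅H, x⁆⁆ + (2 : ℂ) • ⁅E, x⁆ := by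
  rw [leibniz_lie, lie_H_E, smul_lie, add_comm]
lemma H_F (x : M) : ⁅H, ⁅F, x⁆⁆ = ⁅F, ⁅H, x⁆⁆ + (-2 : ℂ) • ⁅F, x⁆ := by
  rw [leibniz_lie, lie_H_F, smul_lie, add_comm]
lemma E_P (x : M) : ⁅E, ⁅P, x⁆⁆ = ⁅P, ⁅E, x⁆⁆ := by
  rw [leibniz_lie, lie_E_P, zero_lie, zero_add]
lemma H_P (x : M) : ⁅H, ⁅P, x⁆⁆ = ⁅P, ⁅H, x⁆⁆ + ⁅P, x⁆ := by
  rw [leibniz_lie, lie_H_P, add_comm]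
lemma F_P (x : M) : ⁅F, ⁅P, x⁆⁆ = ⁅P, ⁅F, x⁆⁆ + ⁅Q, x⁆ := by
  rw [leibniz_lie, lie_F_P, add_comm]
lemma E_Q (x : M) : ⁅E, ⁅Q, x⁆⁆ = ⁅Q, ⁅E, x⁆⁆ + ⁅P, x⁆ := by
  rw [leibniz_lie, lie_E_Q, add_comm]
lemma H_Q (x : M) : ⁅H, ⁅Q, x⁆⁆ = ⁅Q, ⁅H, x⁆⁆ - ⁅Q, x⁆ := by
  rw [leibniz_lie, lie_H_Q, neg_lie, add_comm, sub_eq_add_neg]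
lemma F_Q (x : M) : ⁅F, ⁅Q, x⁆⁆ = ⁅Q, ⁅F, x⁆⁆ := by
  rw [leibniz_lie, lie_F_Q, zero_lie, zero_add]
lemma P_Q (x : M) : ⁅P, ⁅Q, x⁆⁆ = ⁅Q, ⁅P, x⁆⁆ + ⁅Z, x⁆ := by
  rw [leibniz_lie, lie_P_Q, add_comm]
lemma lie_Z_comm (y : Schrodinger) (x : M) : ⁅y, ⁅Z, x⁆⁆ = ⁅Z, ⁅y, x⁆⁆ := by
  rw [leibniz_lie, lie_Z, zero_lie, zero_add]

/-- `x` is a highest weight vector for `sl₂`, of weight `μ` (or zero). -/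
structure IsSingular (x : M) (μ : ℂ) : Prop where
  e : ⁅E, x⁆ = 0
  h : ⁅H, x⁆ = μ • x

/-- The operator that lowers the weight of a singular vector of weight `μ` by one. -/
def lower (μ : ℂ) (x : M) : M := μ • ⁅Q, x⁆ - ⁅P, ⁅F, x⁆⁆

lemma H_pw_F {x : M} {μ : ℂ} (hx : ⁅H, x⁆ = μ • x) (j : ℕ) :
    ⁅H, pw F j x⁆ = (μ - 2 * j) • pw F j x := by
  induction j with
  | zero => simpa using hx
  | succ j ih => rw [pw_succ, H_F, ih, lie_smul]; push_cast; module

lemma H_pw_E {x : M} {μ : ℂ} (hx : ⁅H, x⁆ = μ • x) (j : ℕ) :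
    ⁅H, pw E j x⁆ = (μ + 2 * j) • pw E j x := by
  induction j with
  | zero => simpa using hx
  | succ j ih => rw [pw_succ, H_E, ih, lie_smul]; push_cast; module

namespace IsSingular

variable {x : M} {μ : ℂ} (hx : IsSingular x μ)
include hx

lemma E_pw (j : ℕ) : ⁅E, pw F (j + 1) x⁆ = ((j + 1) * (μ - j)) • pw F j x := by
  induction j with
  | zero => rw [pw_succ, E_F, pw_zero, hx.e, hx.h]; simp
  | succ j ih =>
    rw [pw_succ, E_F, ih, lie_smul, ← pw_succ, H_pw_F hx.h]; push_cast; module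

lemma smul (t : ℂ) : IsSingular (t • x) μ :=
  ⟨by rw [lie_smul, hx.e, smul_zero], by rw [lie_smul, hx.h, smul_comm]⟩

lemma lie_P : IsSingular ⁅P, x⁆ (μ + 1) :=
  ⟨by rw [E_P, hx.e, lie_zero], by rw [H_P, hx.h, lie_smul]; module⟩

lemma pw_P (i : ℕ) : IsSingular (pw P i x) (μ + i) := by
  induction i with
  | zero => simpa using hx
  | succ i ih => rw [pw_succ]; push_cast; rw [← add_assoc]; exact ih.lie_P

/-- The factor `μ` is chosen so that `e (μ q x - p f x) = μ p x - p h x` vanishes. Up to scale this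
is the highest weight vector of type `μ - 1` in `L(1) ⊗ L(μ)`. -/
lemma lower : IsSingular (lower μ x) (μ - 1) := by
  constructor
  · simp only [Schrodinger.lower, lie_sub, lie_smul, E_Q, E_P, E_F, hx.e, hx.h, lie_add, lie_zero]
    module
  · simp only [Schrodinger.lower, lie_sub, lie_smul, H_Q, H_P, H_F, hx.h, lie_add]
    module

/-- The central element enters here through `[p, q] = z`; iterating this identity produces the
lowering coefficients. -/
lemma lower_lie_P :
    Schrodinger.lower (μ + 1) ⁅P, x⁆ = ⁅P, Schrodinger.lower μ x⁆ - (μ + 1) • ⁅Z, x⁆ := by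
  simp only [Schrodinger.lower, lie_sub, lie_smul, F_P, P_Q, lie_add]
  module

/-- Splits `q x` into its components of types `μ + 1` and `μ - 1`, which expresses `q` through `p`,
`f` and the lowering operator. -/
lemma smul_lie_Q : (μ + 1) • ⁅Q, x⁆ = ⁅F, ⁅P, x⁆⁆ + Schrodinger.lower μ x := by
  simp only [Schrodinger.lower, F_P]
  module

/-- At the last nonzero `fⁿ x`, the vector `e fⁿ⁺¹ x = (n + 1)(μ - n) fⁿ x` is zero, which forces `μ
= n`. -/
lemma exists_nat (hx0 : x ≠ 0) (hf : ∃ k, pw F k x = 0) : ∃ n : ℕ, μ = n := by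
  obtain ⟨n, h1, h2⟩ := Nat.exists_not_and_succ_of_not_zero_of_exists
    (p := fun k => pw F k x = 0) (by simpa using hx0) hf
  refine ⟨n, ?_⟩
  have := hx.E_pw n
  rw [h2, lie_zero, eq_comm, smul_eq_zero_iff_left h1, mul_eq_zero, sub_eq_zero] at this
  exact this.resolve_left (Nat.cast_add_one_ne_zero n)

end IsSingular

namespace IsSingular

variable {x : M} {n : ℕ} (hx : IsSingular x n)
include hx

lemma pw_ne_zero (hx0 : x ≠ 0) {j : ℕ} (hj : j ≤ n) : pw F j x ≠ 0 := by
  induction j with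
  | zero => simpa using hx0
  | succ j ih =>
    intro h
    have := hx.E_pw j
    rw [h, lie_zero, eq_comm, smul_eq_zero, mul_eq_zero, sub_eq_zero] at this
    rcases this with (h | h) | h
    · exact Nat.cast_add_one_ne_zero j h
    · have := Nat.cast_injective (R := ℂ) h; omega
    · exact ih (by omega) h

/-- Past index `n` the factor `(j + 1)(n - j)` in `e fʲ⁺¹ x` is never zero, so a nonzero `fⁿ⁺¹ x`
would have nonzero images under all powers of `f`. -/
lemma pw_eq_zero (hf : ∃ k, pw F k x = 0) {j : ℕ} (hj : n < j) : pw F j x = 0 := by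
  refine pw_eq_zero_of_le (i := n + 1) hj ?_
  by_contra hne
  obtain ⟨k, h1, h2⟩ := Nat.exists_not_and_succ_of_not_zero_of_exists
    (p := fun k => pw F (n + 1 + k) x = 0) (by simpa using hne) (by
      obtain ⟨k, hk⟩ := hf
      exact ⟨k, pw_eq_zero_of_le (by omega) hk⟩)
  have := hx.E_pw (n + 1 + k)
  rw [show pw F (n + 1 + k + 1) x = 0 from h2, lie_zero, eq_comm,
    smul_eq_zero_iff_left h1, mul_eq_zero, sub_eq_zero] at this
  rcases this with h | h
  · exact Nat.cast_add_one_ne_zero _ h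
  · have := Nat.cast_injective (R := ℂ) h; omega

end IsSingular

/-- The Casimir operator of `sl₂` plus `i h`; its eigenvalues on `fʲ x`, for `x` singular of
weight `n`, are distinct for distinct pairs `(n, j)`. -/
def diagOp : Module.End ℂ M :=
  let T := LieModule.toEnd ℂ Schrodinger M
  (4 : ℂ) • (T F * T E) + T H * T H + (2 + Complex.I) • T H

lemma diagOp_apply (x : M) :
    diagOp x = (4 : ℂ) • ⁅F, ⁅E, x⁆⁆ + ⁅H, ⁅H, x⁆⁆ + (2 + Complex.I) • ⁅H, x⁆ := rfl

/-- The eigenvalue of `diagOp` on `fʲ x`, for `x` singular of weight `μ`. -/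
def diagVal (μ : ℂ) (j : ℕ) : ℂ := μ * (μ + 2) + Complex.I * (μ - 2 * j)

lemma IsSingular.diagOp_pw {x : M} {μ : ℂ} (hx : IsSingular x μ) (j : ℕ) :
    diagOp (pw F j x) = diagVal μ j • pw F j x := by
  rw [diagOp_apply, H_pw_F hx.h, lie_smul, H_pw_F hx.h, diagVal]
  cases j with
  | zero => rw [pw_zero, hx.e, lie_zero]; module
  | succ j => rw [hx.E_pw, lie_smul, ← pw_succ]; push_cast; module

/-- The real part `n (n + 2)` is strictly increasing in `n`; the imaginary part `n - 2j` then
recovers `j`. -/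
lemma diagVal_inj {m n : ℕ} {i j : ℕ} (h : diagVal m i = diagVal n j) : m = n ∧ i = j := by
  have h1 := congrArg Complex.re h
  have h2 := congrArg Complex.im h
  simp [diagVal] at h1 h2
  have h1' : m * (m + 2) = n * (n + 2) := by exact_mod_cast h1
  have hmn : m = n := by
    rcases lt_trichotomy m n with hlt | rfl | hlt
    · nlinarith
    · rfl
    · nlinarith
  subst hmn
  exact ⟨rfl, by simpa using h2⟩

lemma lie_mem_of_mem_basis {X : Submodule ℂ M}
    (hE : ∀ x ∈ X, ⁅E, x⁆ ∈ X) (hH : ∀ x ∈ X, ⁅H, x⁆ ∈ X) (hF : ∀ x ∈ X, ⁅F, x⁆ ∈ X)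
    (hP : ∀ x ∈ X, ⁅P, x⁆ ∈ X) (hQ : ∀ x ∈ X, ⁅Q, x⁆ ∈ X) (hZ : ∀ x ∈ X, ⁅Z, x⁆ ∈ X)
    (y : Schrodinger) {x : M} (hx : x ∈ X) : ⁅y, x⁆ ∈ X := by
  rw [eq_sum y]
  simp only [add_lie, smul_lie]
  exact X.add_mem (X.add_mem (X.add_mem (X.add_mem (X.add_mem (X.smul_mem _ (hE x hx))
    (X.smul_mem _ (hH x hx))) (X.smul_mem _ (hF x hx))) (X.smul_mem _ (hP x hx)))
    (X.smul_mem _ (hQ x hx))) (X.smul_mem _ (hZ x hx))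

/-! ### The vectors `fʲ pⁱ v` over a bottom vector -/

/-- The vectors `fʲ pⁱ v`. -/
def ladder (v : M) (α : ℕ × ℕ) : M := pw F α.2 (pw P α.1 v)

/-- `v` is a singular vector of weight `n`, annihilated by the lowering operator, in a module
of central charge `c` on which `f` is locally nilpotent. -/
structure IsBottom (v : M) (n : ℕ) (c : ℂ) : Prop where
  ne_zero : v ≠ 0
  singular : IsSingular v n
  lower_eq_zero : lower n v = 0
  charge : HasCentralCharge M c
  nilpotent : ∀ x : M, ∃ k, pw F k x = 0

/-- The scalar by which the lowering operator takes `pⁱ v` to `pⁱ⁻¹ v`. -/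
def lowerCoeff (n : ℕ) (c : ℂ) (i : ℕ) : ℂ := -c * i * (2 * n + i + 1) / 2

namespace IsBottom

variable {v : M} {n : ℕ} {c : ℂ} (hv : IsBottom v n c)
include hv

lemma singular_pw (i : ℕ) : IsSingular (pw P i v) ((n + i : ℕ) : ℂ) := by
  push_cast; exact hv.singular.pw_P i

lemma lower_pw_succ (i : ℕ) :
    lower ((n + (i + 1) : ℕ) : ℂ) (pw P (i + 1) v) = lowerCoeff n c (i + 1) • pw P i v := by
  induction i with
  | zero =>
    have := (hv.singular_pw 0).lower_lie_P
    rw [pw_succ]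
    push_cast at this ⊢
    simp only [pw_zero, add_zero, hv.lower_eq_zero, lie_zero, hv.charge v] at this ⊢
    rw [this, lowerCoeff]
    push_cast
    module
  | succ i ih =>
    have := (hv.singular_pw (i + 1)).lower_lie_P
    rw [ih, lie_smul, ← pw_succ, ← pw_succ, hv.charge] at this
    rw [← add_assoc, Nat.cast_add, Nat.cast_one, this, lowerCoeff, lowerCoeff]
    push_cast
    module

/-- The coefficient vanishes at `i = 0`, so the truncated index `i - 1` is harmless there. -/
lemma lower_pw (i : ℕ) :
    lower ((n + i : ℕ) : ℂ) (pw P i v) = lowerCoeff n c i • pw P (i - 1) v := by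
  cases i with
  | zero => simpa [lowerCoeff] using hv.lower_eq_zero
  | succ i => exact hv.lower_pw_succ i

lemma lowerCoeff_ne_zero (hc : c ≠ 0) (i : ℕ) : lowerCoeff n c (i + 1) ≠ 0 := by
  have h1 : (2 * n + (i + 1 : ℕ) + 1 : ℂ) ≠ 0 := by
    have : ((2 * n + (i + 1) + 1 : ℕ) : ℂ) ≠ 0 := by
      rw [Nat.cast_ne_zero]; omega
    push_cast at this ⊢
    exact this
  have h2 : ((i + 1 : ℕ) : ℂ) ≠ 0 := by rw [Nat.cast_ne_zero]; omega
  rw [lowerCoeff]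
  simp only [neg_mul, ne_eq, div_eq_zero_iff, neg_eq_zero, mul_eq_zero, not_or]
  exact ⟨⟨⟨hc, h2⟩, h1⟩, two_ne_zero⟩

/-- Lowering takes `pⁱ⁺¹ v` to a nonzero multiple of `pⁱ v`. -/
lemma pw_P_ne_zero (hc : c ≠ 0) (i : ℕ) : pw P i v ≠ 0 := by
  induction i with
  | zero => exact hv.ne_zero
  | succ i ih =>
    intro h
    have := hv.lower_pw_succ i
    rw [h, lower, lie_zero, lie_zero, lie_zero, smul_zero, sub_zero, eq_comm, smul_eq_zero] at this
    exact this.elim (hv.lowerCoeff_ne_zero hc i) ih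

lemma ladder_ne_zero (hc : c ≠ 0) {i j : ℕ} (hj : j ≤ n + i) : ladder v (i, j) ≠ 0 :=
  (hv.singular_pw i).pw_ne_zero (hv.pw_P_ne_zero hc i) hj

lemma ladder_eq_zero {i j : ℕ} (hj : n + i < j) : ladder v (i, j) = 0 :=
  (hv.singular_pw i).pw_eq_zero (hv.nilpotent _) hj

omit hv in
lemma _root_.Schrodinger.F_ladder (i j : ℕ) : ⁅F, ladder v (i, j)⁆ = ladder v (i, j + 1) :=
  (pw_succ F j _).symm

lemma H_ladder (i j : ℕ) : ⁅H, ladder v (i, j)⁆ = ((n + i : ℕ) - 2 * j : ℂ) • ladder v (i, j) :=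
  H_pw_F (hv.singular_pw i).h j

lemma E_ladder (i j : ℕ) :
    ⁅E, ladder v (i, j)⁆ = (j * ((n + i : ℕ) + 1 - j) : ℂ) • ladder v (i, j - 1) := by
  cases j with
  | zero => simpa [ladder] using (hv.singular_pw i).e
  | succ j =>
    refine ((hv.singular_pw i).E_pw j).trans ?_
    simp only [ladder, Nat.add_sub_cancel]
    push_cast
    module

/-- For `j = 0` this is `smul_lie_Q` at `pⁱ v`, divided by `n + i + 1`; the general case follows
because `q` commutes with `f`. -/
lemma Q_ladder (i j : ℕ) : ⁅Q, ladder v (i, j)⁆ = ((n + i + 1 : ℕ) : ℂ)⁻¹ •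
    (ladder v (i + 1, j + 1) + lowerCoeff n c i • ladder v (i - 1, j)) := by
  rw [eq_inv_smul_iff₀ (by rw [Nat.cast_ne_zero]; omega)]
  induction j with
  | zero =>
    have := (hv.singular_pw i).smul_lie_Q
    rw [hv.lower_pw] at this
    push_cast at this ⊢
    rw [ladder, pw_zero, this, ladder, ladder, pw_zero, pw_succ, pw_zero, pw_succ]
  | succ j ih =>
    rw [← F_ladder, ← F_Q, ← lie_smul, ih, lie_add, lie_smul, F_ladder, F_ladder]

/-- Since `[f, p] = q` commutes with `f`, one has `p fʲ = fʲ p - j q fʲ⁻¹`. -/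
lemma P_ladder (i j : ℕ) : ⁅P, ladder v (i, j)⁆ =
    ladder v (i + 1, j) - (j : ℂ) • ⁅Q, ladder v (i, j - 1)⁆ := by
  induction j with
  | zero => simp [ladder, pw_succ]
  | succ j ih =>
    have h := F_P (ladder v (i, j))
    rw [F_ladder, ih, lie_sub, lie_smul, F_ladder, F_Q, F_ladder] at h
    rw [← sub_eq_iff_eq_add] at h
    rw [← h, Nat.add_sub_cancel]
    cases j with
    | zero => simp
    | succ j => rw [Nat.add_sub_cancel]; push_cast; module

/-- The span of the vectors `fʲ pⁱ v`. -/
def span : LieSubmodule ℂ Schrodinger M where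
  __ := Submodule.span ℂ (Set.range (ladder v))
  lie_mem {y x} hx := by
    have key : ∀ y : Schrodinger, (∀ α, ⁅y, ladder v α⁆ ∈ Submodule.span ℂ (Set.range (ladder v))) →
        ∀ x ∈ Submodule.span ℂ (Set.range (ladder v)),
          ⁅y, x⁆ ∈ Submodule.span ℂ (Set.range (ladder v)) := by
      intro y hy x hx
      have : Submodule.span ℂ (Set.range (ladder v)) ≤
          (Submodule.span ℂ (Set.range (ladder v))).comap (LieModule.toEnd ℂ Schrodinger M y) := by
        rw [Submodule.span_le]
        rintro _ ⟨α, rfl⟩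
        exact hy α
      exact this hx
    have mem : ∀ i j, ladder v (i, j) ∈ Submodule.span ℂ (Set.range (ladder v)) :=
      fun i j => Submodule.subset_span ⟨(i, j), rfl⟩
    have hQ : ∀ i j, ⁅Q, ladder v (i, j)⁆ ∈ Submodule.span ℂ (Set.range (ladder v)) := by
      intro i j
      rw [hv.Q_ladder]
      exact Submodule.smul_mem _ _ (Submodule.add_mem _ (mem _ _) (Submodule.smul_mem _ _ (mem _ _)))
    refine lie_mem_of_mem_basis (key E ?_) (key H ?_) (key F ?_) (key P ?_) (key Q ?_) (key Z ?_)
      y hx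
    · rintro ⟨i, j⟩
      rw [hv.E_ladder]
      exact Submodule.smul_mem _ _ (mem _ _)
    · rintro ⟨i, j⟩
      rw [hv.H_ladder]
      exact Submodule.smul_mem _ _ (mem _ _)
    · rintro ⟨i, j⟩
      rw [F_ladder]
      exact mem _ _
    · rintro ⟨i, j⟩
      rw [hv.P_ladder]
      exact Submodule.sub_mem _ (mem _ _) (Submodule.smul_mem _ _ (hQ _ _))
    · rintro ⟨i, j⟩
      exact hQ i j
    · intro α
      rw [hv.charge]
      exact Submodule.smul_mem _ _ (mem _ _)

lemma diagOp_ladder (α : ℕ × ℕ) :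
    diagOp (ladder v α) = diagVal ((n + α.1 : ℕ) : ℂ) α.2 • ladder v α :=
  (hv.singular_pw α.1).diagOp_pw α.2

omit hv in
lemma _root_.Schrodinger.diagVal_injective (n : ℕ) :
    Function.Injective fun α : ℕ × ℕ => diagVal ((n + α.1 : ℕ) : ℂ) α.2 := by
  rintro ⟨i, j⟩ ⟨i', j'⟩ h
  have := diagVal_inj h
  simp only [Prod.mk.injEq]
  omega

end IsBottom

end Rep

/-! ### Irreducibility and the modules `L(n)` -/

lemma lieSubmodule_eq_top {𝔤 M : Type*} [LieRing 𝔤] [AddCommGroup M] [Module ℂ M]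
    [LieRingModule 𝔤 M] (h : LieModule.IsIrreducible ℂ 𝔤 M) {X : LieSubmodule ℂ 𝔤 M}
    (hX : X ≠ ⊥) : X = ⊤ :=
  (IsSimpleOrder.eq_bot_or_eq_top X).resolve_left hX

lemma isIrreducible_of_equiv {𝔤 M N : Type*} [LieRing 𝔤] [LieAlgebra ℂ 𝔤]
    [AddCommGroup M] [Module ℂ M] [LieRingModule 𝔤 M]
    [AddCommGroup N] [Module ℂ N] [LieRingModule 𝔤 N]
    (f : M ≃ₗ⁅ℂ, 𝔤⁆ N) (h : LieModule.IsIrreducible ℂ 𝔤 N) : LieModule.IsIrreducible ℂ 𝔤 M := by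
  have hN : Nontrivial N := LieModule.nontrivial_of_isIrreducible ℂ 𝔤 N
  have : Nontrivial M := f.symm.injective.nontrivial
  refine LieModule.IsIrreducible.mk fun X hX => ?_
  have h1 : X.comap f.symm.toLieModuleHom = ⊤ := by
    refine lieSubmodule_eq_top h fun h0 => hX ?_
    rw [LieSubmodule.eq_bot_iff] at h0 ⊢
    intro x hx
    have := h0 (f x) (by
      rw [LieSubmodule.mem_comap]
      exact (congrArg (· ∈ X) (f.symm_apply_apply x)).mpr hx)
    exact f.injective (this.trans (map_zero f.toLieModuleHom).symm)
  rw [eq_top_iff]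
  intro x _
  have : f x ∈ X.comap f.symm.toLieModuleHom := h1 ▸ LieSubmodule.mem_top _
  rw [LieSubmodule.mem_comap] at this
  exact (congrArg (· ∈ X) (f.symm_apply_apply x)).mp this

/-- `e` as an element of `sl₂`. -/
def sE : sl2 := ⟨E, by simp [sl2, E]⟩
/-- `h` as an element of `sl₂`. -/
def sH : sl2 := ⟨H, by simp [sl2, H]⟩
/-- `f` as an element of `sl₂`. -/
def sF : sl2 := ⟨F, by simp [sl2, F]⟩

lemma sl2_eq_sum (y : sl2) :
    (y : Schrodinger) = (y : Schrodinger).e • E + (y : Schrodinger).h • H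
      + (y : Schrodinger).f • F := by
  obtain ⟨y, h1, h2, h3⟩ := y
  ext <;> simp [E, H, F, h1, h2, h3]

section Rep

variable {M : Type*} [AddCommGroup M] [Module ℂ M] [LieRingModule Schrodinger M]
  [LieModule ℂ Schrodinger M]

lemma lie_mem_E (W : LieSubmodule ℂ sl2 M) {x : M} (hx : x ∈ W) : ⁅E, x⁆ ∈ W := W.lie_mem (x := sE) hx
lemma lie_mem_H (W : LieSubmodule ℂ sl2 M) {x : M} (hx : x ∈ W) : ⁅H, x⁆ ∈ W := W.lie_mem (x := sH) hx
lemma lie_mem_F (W : LieSubmodule ℂ sl2 M) {x : M} (hx : x ∈ W) : ⁅F, x⁆ ∈ W := W.lie_mem (x := sF) hx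

lemma pw_mem {X : Submodule ℂ M} {y : Schrodinger} (hX : ∀ x ∈ X, ⁅y, x⁆ ∈ X) (j : ℕ) {x : M}
    (hx : x ∈ X) : pw y j x ∈ X := by
  induction j with
  | zero => exact hx
  | succ j ih => rw [pw_succ]; exact hX _ ih

/-- As long as `j < n`, `e` undoes one step of `f` up to the nonzero factor `(j + 1)(n - j)`. -/
lemma IsSingular.mem_of_pw_mem {x : M} {n : ℕ} (hx : IsSingular x n) {X : Submodule ℂ M}
    (hX : ∀ x ∈ X, ⁅E, x⁆ ∈ X) {j : ℕ} (hj : j ≤ n) (h : pw F j x ∈ X) : x ∈ X := by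
  induction j with
  | zero => exact h
  | succ j ih =>
    refine ih (by omega) ((X.smul_mem_iff (s := ((j + 1) * (n - j) : ℂ)) ?_).1 (hx.E_pw j ▸ hX _ h))
    refine mul_ne_zero (Nat.cast_add_one_ne_zero j) ?_
    rw [sub_ne_zero]
    exact fun h => by have := Nat.cast_injective (R := ℂ) h; omega

end Rep

namespace L

variable {n : ℕ}

/-- The highest weight vector of `L(n)`. -/
def top : L n := fun i => if (i : ℕ) = 0 then 1 else 0

lemma coord_top (k : ℕ) : (top : L n).coord k = if k = 0 then 1 else 0 := by
  unfold coord top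
  by_cases h : k < n + 1
  · rw [dif_pos h]
  · rw [dif_neg h, if_neg (by omega)]

@[simp] lemma coord_zero (k : ℕ) : (0 : L n).coord k = 0 := by
  unfold coord
  split_ifs <;> rfl

lemma coord_of_lt (v : L n) {k : ℕ} (hk : n < k) : v.coord k = 0 := by
  rw [coord, dif_neg (by omega)]

lemma top_ne_zero : (top : L n) ≠ 0 := by
  intro h
  have := congrArg (fun v => v.coord 0) h
  simp [coord_top] at this

lemma isSingular_top : IsSingular (top : L n) n := by
  constructor
  · ext k hk
    rw [coord_lie _ _ _ hk]
    simp [E, coord_top]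
  · ext k hk
    rw [coord_lie _ _ _ hk]
    rw [coord_smul, coord_top]
    by_cases h : k = 0 <;> simp [h, H]

lemma coord_pw_top (j k : ℕ) (hk : k < n + 1) :
    (pw F j (top : L n)).coord k = if k = j then (j.factorial : ℂ) else 0 := by
  induction j generalizing k with
  | zero => simp [coord_top]
  | succ j ih =>
    rw [pw_succ, coord_lie _ _ _ hk]
    cases k with
    | zero => simp [F]
    | succ k =>
      rw [Nat.add_sub_cancel, ih k (by omega)]
      simp only [F, Nat.add_right_cancel_iff, Nat.factorial_succ]
      split_ifs with h
      · subst h; push_cast; ring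
      · ring

lemma eq_sum_pw (x : L n) :
    x = ∑ i ∈ Finset.range (n + 1), (x.coord i * (i.factorial : ℂ)⁻¹) • pw F i (top : L n) := by
  have hs : ∀ (s : Finset ℕ) (g : ℕ → L n) (k : ℕ),
      (∑ i ∈ s, g i).coord k = ∑ i ∈ s, (g i).coord k := by
    intro s g k
    classical
    induction s using Finset.induction_on with
    | empty => simp
    | insert a s ha ih => rw [Finset.sum_insert ha, Finset.sum_insert ha, coord_add, ih]
  ext k hk
  rw [hs, Finset.sum_eq_single k]
  · rw [coord_smul, coord_pw_top _ _ hk, if_pos rfl, mul_assoc,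
      inv_mul_cancel₀ (Nat.cast_ne_zero.2 k.factorial_ne_zero), mul_one]
  · intro i _ hi
    rw [coord_smul, coord_pw_top _ _ hk, if_neg (Ne.symm hi), mul_zero]
  · intro h
    exact absurd (Finset.mem_range.2 hk) h

/-- The weights of `L(n)` are distinct, so `X` contains some `fʲ top`; powers of `e` lead from it
back to `top`, which generates under `f`. -/
lemma eq_top_of_ne_bot (X : Submodule ℂ (L n)) (hE : ∀ x ∈ X, ⁅E, x⁆ ∈ X)
    (hH : ∀ x ∈ X, ⁅H, x⁆ ∈ X) (hF : ∀ x ∈ X, ⁅F, x⁆ ∈ X) (h0 : X ≠ ⊥) : X = ⊤ := by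
  obtain ⟨x, hx, hx0⟩ := X.ne_bot_iff.1 h0
  obtain ⟨j, hj0, hj⟩ := exists_mem_of_eigenfamily (A := LieModule.toEnd ℂ Schrodinger (L n) H)
    (l := fun j : Fin (n + 1) => (n : ℂ) - 2 * (j : ℕ)) (b := fun j => pw F (j : ℕ) top) hH
    (fun i j h => by
      apply Fin.ext
      simpa using h)
    (fun j => H_pw_F isSingular_top.h j) hx hx0 (by
      rw [eq_sum_pw x]
      refine Submodule.sum_mem _ fun i hi => Submodule.smul_mem _ _ (Submodule.subset_span ?_)
      exact ⟨⟨i, Finset.mem_range.1 hi⟩, rfl⟩)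
  have htop : top ∈ X := isSingular_top.mem_of_pw_mem hE (by omega) hj
  rw [eq_top_iff]
  intro y _
  rw [eq_sum_pw y]
  exact Submodule.sum_mem _ fun i _ => Submodule.smul_mem _ _ (pw_mem hF _ htop)

instance : Nontrivial (L n) := ⟨⟨top, 0, top_ne_zero⟩⟩

instance : Module.Finite ℂ (L n) := inferInstanceAs (Module.Finite ℂ (Fin (n + 1) → ℂ))

lemma finrank : Module.finrank ℂ (L n) = n + 1 := by
  change Module.finrank ℂ (Fin (n + 1) → ℂ) = n + 1
  simp

variable (n) in
lemma isIrreducible_sl2 : LieModule.IsIrreducible ℂ sl2 (L n) :=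
  LieModule.IsIrreducible.mk fun X hX => by
    rw [← LieSubmodule.toSubmodule_inj, LieSubmodule.top_toSubmodule]
    refine eq_top_of_ne_bot (X : Submodule ℂ (L n)) (fun _ => lie_mem_E X) (fun _ => lie_mem_H X)
      (fun _ => lie_mem_F X) ?_
    simpa using hX

variable (n) in
lemma isIrreducible : LieModule.IsIrreducible ℂ Schrodinger (L n) :=
  LieModule.IsIrreducible.mk fun X hX => by
    rw [← LieSubmodule.toSubmodule_inj, LieSubmodule.top_toSubmodule]
    refine eq_top_of_ne_bot (X : Submodule ℂ (L n)) (fun _ => X.lie_mem) (fun _ => X.lie_mem)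
      (fun _ => X.lie_mem) ?_
    simpa using hX

end L

/-! ### Strings generated by singular vectors -/

section Rep

variable {M : Type*} [AddCommGroup M] [Module ℂ M] [LieRingModule Schrodinger M]
  [LieModule ℂ Schrodinger M]

/-- The linear map `L(n) → M` that takes the highest weight vector to `v`. -/
def stringMap (n : ℕ) (v : M) : L n →ₗ[ℂ] M where
  -- In the standard basis `f vᵢ = (i + 1) vᵢ₊₁`, so `vᵢ = fⁱ v₀ / i!`.
  toFun x := ∑ i ∈ Finset.range (n + 1), (x.coord i * (i.factorial : ℂ)⁻¹) • pw F i v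
  map_add' x y := by
    rw [← Finset.sum_add_distrib]
    refine Finset.sum_congr rfl fun i _ => ?_
    rw [L.coord_add]; module
  map_smul' t x := by
    rw [Finset.smul_sum]
    refine Finset.sum_congr rfl fun i _ => ?_
    rw [L.coord_smul, RingHom.id_apply]; module

lemma stringMap_apply (n : ℕ) (v : M) (x : L n) : stringMap n v x =
    ∑ i ∈ Finset.range (n + 1), (x.coord i * (i.factorial : ℂ)⁻¹) • pw F i v := rfl

lemma stringMap_top (n : ℕ) (v : M) : stringMap n v L.top = v := by
  rw [stringMap_apply, Finset.sum_eq_single 0]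
  · simp [L.coord_top]
  · intro i _ hi
    simp [L.coord_top, hi]
  · simp

lemma stringMap_H {n : ℕ} {v : M} (hv : IsSingular v n) (x : L n) :
    stringMap n v ⁅H, x⁆ = ⁅H, stringMap n v x⁆ := by
  rw [stringMap_apply, stringMap_apply, lie_sum]
  refine Finset.sum_congr rfl fun i hi => ?_
  rw [L.coord_lie _ _ _ (Finset.mem_range.1 hi), lie_smul, H_pw_F hv.h]
  simp only [H]
  module

/-- The hypothesis serves the last basis vector: `f` kills it in `L(n)`, while its image is sent to
a multiple of `fⁿ⁺¹ v`. -/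
lemma stringMap_F {n : ℕ} {v : M} (hf : pw F (n + 1) v = 0) (x : L n) :
    stringMap n v ⁅F, x⁆ = ⁅F, stringMap n v x⁆ := by
  rw [stringMap_apply, stringMap_apply, lie_sum, Finset.sum_range_succ', Finset.sum_range_succ,
    lie_smul, ← pw_succ, hf, smul_zero]
  congr 1
  · refine Finset.sum_congr rfl fun i hi => ?_
    have hi' := Finset.mem_range.1 hi
    rw [L.coord_lie _ _ _ (by omega), lie_smul, ← pw_succ, Nat.add_sub_cancel, Nat.factorial_succ]
    congr 1
    have h1 : ((i + 1 : ℕ) : ℂ) ≠ 0 := by rw [Nat.cast_ne_zero]; omega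
    simp only [F]
    push_cast at h1 ⊢
    rw [mul_inv]
    field_simp
    ring
  · rw [L.coord_lie _ _ _ (by omega)]
    simp [F]

lemma stringMap_E {n : ℕ} {v : M} (hv : IsSingular v n) (x : L n) :
    stringMap n v ⁅E, x⁆ = ⁅E, stringMap n v x⁆ := by
  rw [stringMap_apply, stringMap_apply, lie_sum, Finset.sum_range_succ, Finset.sum_range_succ',
    pw_zero, lie_smul _ E v, hv.e, smul_zero]
  congr 1
  · refine Finset.sum_congr rfl fun i hi => ?_
    have hi' := Finset.mem_range.1 hi
    rw [L.coord_lie _ _ _ (by omega), lie_smul, hv.E_pw, smul_smul, Nat.factorial_succ]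
    congr 1
    have h1 : (i + 1 : ℂ) ≠ 0 := Nat.cast_add_one_ne_zero i
    simp only [E]
    push_cast
    rw [mul_inv]
    field_simp
    ring
  · rw [L.coord_lie _ _ _ (by omega), L.coord_of_lt x (Nat.lt_succ_self n)]
    simp [E]

/-- The homomorphism of `sl₂`-modules `L(n) → M` that takes the highest weight vector to `v`. -/
def stringHom {n : ℕ} {v : M} (hv : IsSingular v n) (hf : pw F (n + 1) v = 0) :
    L n →ₗ⁅ℂ, sl2⁆ M where
  __ := stringMap n v
  map_lie' {y x} := by
    change stringMap n v ⁅(y : Schrodinger), x⁆ = ⁅(y : Schrodinger), stringMap n v x⁆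
    rw [sl2_eq_sum y]
    simp only [add_lie, smul_lie, map_add, map_smul, stringMap_E hv, stringMap_H hv,
      stringMap_F hf]

lemma stringHom_apply {n : ℕ} {v : M} (hv : IsSingular v n) (hf : pw F (n + 1) v = 0) (x : L n) :
    stringHom hv hf x = stringMap n v x := rfl

/-- `L(n)` is simple, and the kernel misses the highest weight vector because `v ≠ 0`. -/
lemma stringHom_injective {n : ℕ} {v : M} (hv : IsSingular v n) (hf : pw F (n + 1) v = 0)
    (hv0 : v ≠ 0) : Function.Injective (stringHom hv hf) := by
  rw [← LieModuleHom.ker_eq_bot]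
  by_contra h
  have h1 := lieSubmodule_eq_top (L.isIrreducible_sl2 n) h
  have h2 : L.top ∈ (stringHom hv hf).ker := h1 ▸ LieSubmodule.mem_top _
  rw [LieModuleHom.mem_ker, stringHom_apply, stringMap_top] at h2
  exact hv0 h2

/-- The `sl₂`-submodule generated by a singular vector. -/
def stringSub {n : ℕ} {v : M} (hv : IsSingular v n) (hf : pw F (n + 1) v = 0) :
    LieSubmodule ℂ sl2 M := (stringHom hv hf).range

/-- The `sl₂`-submodule generated by a singular vector of weight `n` is isomorphic to `L(n)`. -/
def stringEquiv {n : ℕ} {v : M} (hv : IsSingular v n) (hf : pw F (n + 1) v = 0) (hv0 : v ≠ 0) :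
    L n ≃ₗ⁅ℂ, sl2⁆ stringSub hv hf :=
  { LinearEquiv.ofBijective
      ((stringHom hv hf : L n →ₗ[ℂ] M).codRestrict (stringSub hv hf : Submodule ℂ M)
        (fun x => (LieModuleHom.mem_range _ _).2 ⟨x, rfl⟩))
      ⟨fun x y h => stringHom_injective hv hf hv0 (congrArg Subtype.val h), by
        rintro ⟨y, hy⟩
        obtain ⟨x, hx⟩ := (LieModuleHom.mem_range _ _).1 hy
        exact ⟨x, Subtype.ext hx⟩⟩ with
    map_lie' := fun {y x} => Subtype.ext (LieModuleHom.map_lie (stringHom hv hf) y x) }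

lemma mem_stringSub {n : ℕ} {v : M} (hv : IsSingular v n) (hf : pw F (n + 1) v = 0) :
    v ∈ stringSub hv hf :=
  (LieModuleHom.mem_range _ _).2 ⟨L.top, stringMap_top n v⟩

lemma stringSub_le {n : ℕ} {v : M} (hv : IsSingular v n) (hf : pw F (n + 1) v = 0)
    {X : Submodule ℂ M} (h : ∀ j, pw F j v ∈ X) :
    (stringSub hv hf : Submodule ℂ M) ≤ X := by
  intro y hy
  obtain ⟨x, rfl⟩ := (LieModuleHom.mem_range _ _).1 hy
  rw [stringHom_apply, stringMap_apply]
  exact X.sum_mem fun i _ => X.smul_mem _ (h i)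

lemma isType_of_isSingular {n : ℕ} {v : M} (hv : IsSingular v n) (hf : pw F (n + 1) v = 0)
    (hv0 : v ≠ 0) : IsType M n :=
  ⟨stringSub hv hf, ⟨(stringEquiv hv hf hv0).symm⟩⟩

lemma exists_isSingular_of_equiv {n : ℕ} {W : LieSubmodule ℂ sl2 M} (f : W ≃ₗ⁅ℂ, sl2⁆ L n) :
    ∃ v ∈ W, v ≠ 0 ∧ IsSingular v n := by
  refine ⟨f.symm L.top, (f.symm L.top).2, fun h => ?_, ?_, ?_⟩
  · have : f.symm L.top = 0 := Subtype.ext h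
    exact L.top_ne_zero (f.symm.injective (this.trans (map_zero f.symm.toLieModuleHom).symm))
  · have h1 : ⁅sE, f.symm L.top⁆ = f.symm ⁅sE, L.top⁆ :=
      (LieModuleHom.map_lie f.symm.toLieModuleHom sE L.top).symm
    have h2 : ⁅sE, (L.top : L n)⁆ = 0 := L.isSingular_top.e
    rw [h2] at h1
    exact (congrArg Subtype.val h1).trans
      (congrArg Subtype.val (map_zero f.symm.toLieModuleHom))
  · have h1 : ⁅sH, f.symm L.top⁆ = f.symm ⁅sH, L.top⁆ :=
      (LieModuleHom.map_lie f.symm.toLieModuleHom sH L.top).symm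
    have h2 : ⁅sH, (L.top : L n)⁆ = (n : ℂ) • L.top := L.isSingular_top.h
    rw [h2] at h1
    exact (congrArg Subtype.val h1).trans
      (congrArg Subtype.val (map_smul f.symm.toLieModuleHom (n : ℂ) L.top))

lemma IsType.exists_isSingular {n : ℕ} (h : IsType M n) : ∃ v : M, v ≠ 0 ∧ IsSingular v n := by
  obtain ⟨W, ⟨f⟩⟩ := h
  obtain ⟨v, -, h⟩ := exists_isSingular_of_equiv f
  exact ⟨v, h⟩

/-- An operator that takes eigenvectors to eigenvectors with eigenvalues in arithmetic progression
is nilpotent on eigenvectors that lie in an invariant finite-dimensional subspace. -/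
lemma exists_pow_eq_zero {M : Type*} [AddCommGroup M] [Module ℂ M] (A : Module.End ℂ M)
    (X : Submodule ℂ M) [FiniteDimensional ℂ X] {y : ℕ → M} (hy : ∀ j, y j ∈ X) {μ d : ℂ}
    (hd : d ≠ 0) (h : ∀ j : ℕ, A (y j) = (μ + d * j) • y j) : ∃ j, y j = 0 := by
  by_contra! hne
  have hli : LinearIndependent ℂ y := by
    refine Module.End.eigenvectors_linearIndependent' A (fun j : ℕ => μ + d * j) ?_ y fun j => ?_
    · intro i j hij
      simpa [hd] using hij
    · exact ⟨Module.End.mem_eigenspace_iff.2 (h j), hne j⟩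
  have hli' : LinearIndependent ℂ (fun j => (⟨y j, hy j⟩ : X)) :=
    LinearIndependent.of_comp X.subtype hli
  exact not_finite_iff_infinite.2 inferInstance (LinearIndependent.finite hli')

lemma eq_stringSub {W : LieSubmodule ℂ sl2 M} (hW : LieModule.IsIrreducible ℂ sl2 W) {n : ℕ}
    {v : M} (hvW : v ∈ W) (hv0 : v ≠ 0) (hv : IsSingular v n) (hf : pw F (n + 1) v = 0) :
    W = stringSub hv hf := by
  have hle : stringSub hv hf ≤ W :=
    stringSub_le (X := (W : Submodule ℂ M)) hv hf
      (fun j => pw_mem (fun _ => lie_mem_F W) j hvW)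
  refine le_antisymm (fun x hx => ?_) hle
  have := lieSubmodule_eq_top hW (X := (stringSub hv hf).comap W.incl) (by
    rw [Ne, LieSubmodule.eq_bot_iff]
    intro h
    exact hv0 (congrArg Subtype.val (h ⟨_, hvW⟩ (mem_stringSub hv hf))))
  have hx' : (⟨x, hx⟩ : W) ∈ (stringSub hv hf).comap W.incl := this ▸ LieSubmodule.mem_top _
  exact hx'

/-- A finite-dimensional irreducible `sl₂`-module is generated by a highest weight vector. -/
lemma exists_singular_of_irreducible (W : LieSubmodule ℂ sl2 M)
    (hW : LieModule.IsIrreducible ℂ sl2 W) (hfd : FiniteDimensional ℂ W) :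
    ∃ (n : ℕ) (v : M), v ∈ W ∧ v ≠ 0 ∧ IsSingular v n ∧ pw F (n + 1) v = 0 := by
  have : Nontrivial W := LieModule.nontrivial_of_isIrreducible ℂ sl2 W
  have hfd' : FiniteDimensional ℂ (W : Submodule ℂ M) := hfd
  obtain ⟨μ, hμ⟩ := Module.End.exists_eigenvalue (LieModule.toEnd ℂ sl2 W sH)
  obtain ⟨w, hw⟩ := hμ.exists_hasEigenvector
  have hw1 : ⁅H, (w : M)⁆ = μ • (w : M) := congrArg Subtype.val hw.apply_eq_smul
  have hw0 : (w : M) ≠ 0 := fun h => hw.2 (Subtype.ext h)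
  -- The last nonzero vector among the `eᵏ w`, for a weight vector `w`, is singular.
  obtain ⟨k, hk1, hk2⟩ := Nat.exists_not_and_succ_of_not_zero_of_exists
    (p := fun k => pw E k (w : M) = 0) (by simpa using hw0)
    (exists_pow_eq_zero (LieModule.toEnd ℂ Schrodinger M H) (W : Submodule ℂ M)
      (fun j => pw_mem (fun _ => lie_mem_E W) j w.2) two_ne_zero (fun j => H_pw_E hw1 j))
  have hkW : pw E k (w : M) ∈ W :=
    pw_mem (X := (W : Submodule ℂ M)) (fun _ => lie_mem_E W) k w.2
  have hs : IsSingular (pw E k (w : M)) (μ + 2 * k) :=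
    ⟨by rw [← pw_succ]; exact hk2, H_pw_E hw1 k⟩
  have hfn := exists_pow_eq_zero (LieModule.toEnd ℂ Schrodinger M H) (W : Submodule ℂ M)
    (y := fun j => pw F j (pw E k (w : M))) (μ := μ + 2 * k) (d := -2)
      (fun j => pw_mem (fun _ => lie_mem_F W) j hkW) (by norm_num)
      (fun j => by
        refine (H_pw_F hs.h j).trans ?_
        rw [neg_mul, sub_eq_add_neg])
  obtain ⟨n, hn⟩ := hs.exists_nat hk1 hfn
  rw [hn] at hs
  exact ⟨n, _, hkW, hk1, hs, hs.pw_eq_zero hfn (Nat.lt_succ_self n)⟩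

end Rep

/-! ### Modules generated by a bottom vector -/

section Rep

variable {M : Type*} [AddCommGroup M] [Module ℂ M] [LieRingModule Schrodinger M]
  [LieModule ℂ Schrodinger M]

/-- The Casimir operator of `sl₂`. -/
def casimir : Module.End ℂ M :=
  let T := LieModule.toEnd ℂ Schrodinger M
  (4 : ℂ) • (T F * T E) + T H * T H + (2 : ℂ) • T H

lemma casimir_apply (x : M) :
    casimir x = (4 : ℂ) • ⁅F, ⁅E, x⁆⁆ + ⁅H, ⁅H, x⁆⁆ + (2 : ℂ) • ⁅H, x⁆ := rfl

lemma IsSingular.casimir_pw {x : M} {μ : ℂ} (hx : IsSingular x μ) (j : ℕ) :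
    casimir (pw F j x) = (μ * (μ + 2)) • pw F j x := by
  rw [casimir_apply, H_pw_F hx.h, lie_smul, H_pw_F hx.h]
  cases j with
  | zero => rw [pw_zero, hx.e, lie_zero]; push_cast; module
  | succ j => rw [hx.E_pw, lie_smul, ← pw_succ]; push_cast; module

namespace IsBottom

variable {v : M} {n : ℕ} {c : ℂ} (hv : IsBottom v n c)
include hv

lemma mem_span (α : ℕ × ℕ) : ladder v α ∈ hv.span := Submodule.subset_span ⟨α, rfl⟩

lemma span_eq_top (h : LieModule.IsIrreducible ℂ Schrodinger M) : hv.span = ⊤ := by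
  refine lieSubmodule_eq_top h fun h0 => hv.ne_zero ?_
  exact (LieSubmodule.eq_bot_iff _).1 h0 _ (hv.mem_span (0, 0))

lemma mem_span_ladder (ht : hv.span = ⊤) (x : M) :
    x ∈ Submodule.span ℂ (Set.range (ladder v)) := by
  have : x ∈ hv.span := ht ▸ LieSubmodule.mem_top x
  exact this

/-- The line through `x` is stable under `diagOp`, so it contains some nonzero `fʲ pⁱ v`. Comparing
eigenvalues gives `m = n + i`. -/
lemma le_of_isSingular (ht : hv.span = ⊤) {m : ℕ} {x : M} (hx0 : x ≠ 0) (hx : IsSingular x m) :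
    n ≤ m := by
  have hdx : diagOp x = diagVal m 0 • x := hx.diagOp_pw 0
  obtain ⟨α, h0, hα⟩ := exists_mem_of_eigenfamily (A := diagOp) (X := Submodule.span ℂ {x})
    (l := fun α : ℕ × ℕ => diagVal ((n + α.1 : ℕ) : ℂ) α.2) (by
      intro y hy
      obtain ⟨t, rfl⟩ := Submodule.mem_span_singleton.1 hy
      rw [map_smul, hdx]
      exact Submodule.smul_mem _ _ (Submodule.smul_mem _ _ (Submodule.mem_span_singleton_self x)))
    (diagVal_injective n) hv.diagOp_ladder (Submodule.mem_span_singleton_self x) hx0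
    (hv.mem_span_ladder ht x)
  obtain ⟨t, ht⟩ := Submodule.mem_span_singleton.1 hα
  have h1 := hv.diagOp_ladder α
  rw [← ht, map_smul, hdx, smul_comm] at h1
  rw [← ht] at h0
  have := diagVal_inj (smul_left_injective ℂ h0 h1)
  omega

lemma isMinimalType (ht : hv.span = ⊤) : IsMinimalType M n := by
  refine ⟨isType_of_isSingular hv.singular
    (hv.singular.pw_eq_zero (hv.nilpotent _) (Nat.lt_succ_self n)) hv.ne_zero, fun m hm => ?_⟩
  obtain ⟨x, hx0, hx⟩ := IsType.exists_isSingular hm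
  exact hv.le_of_isSingular ht hx0 hx

/-- A nonzero submodule contains some nonzero `fʲ pⁱ v` by the separation of eigenvalues. Raising by
`e` gives `pⁱ v`, then lowering gives `v`, because the lowering coefficients are nonzero for `c ≠
0`. -/
lemma isIrreducible (hc : c ≠ 0) (ht : hv.span = ⊤) : LieModule.IsIrreducible ℂ Schrodinger M := by
  have : Nontrivial M := ⟨v, 0, hv.ne_zero⟩
  refine LieModule.IsIrreducible.mk fun X hX => ?_
  obtain ⟨x, hx, hx0⟩ := (Submodule.ne_bot_iff (X : Submodule ℂ M)).1 (by simpa using hX)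
  have hX' : ∀ y : Schrodinger, ∀ x ∈ (X : Submodule ℂ M), ⁅y, x⁆ ∈ (X : Submodule ℂ M) :=
    fun y x hx => X.lie_mem hx
  obtain ⟨⟨i, j⟩, h0, hα⟩ := exists_mem_of_eigenfamily (A := diagOp) (X := (X : Submodule ℂ M))
    (l := fun α : ℕ × ℕ => diagVal ((n + α.1 : ℕ) : ℂ) α.2) (by
      intro y hy
      rw [diagOp_apply]
      exact add_mem (add_mem (Submodule.smul_mem _ _ (hX' _ _ (hX' _ _ hy)))
        (hX' _ _ (hX' _ _ hy))) (Submodule.smul_mem _ _ (hX' _ _ hy)))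
    (diagVal_injective n) hv.diagOp_ladder hx hx0 (hv.mem_span_ladder ht x)
  have hj : j ≤ n + i := by
    by_contra h
    exact h0 (hv.ladder_eq_zero (by omega))
  have hi : pw P i v ∈ (X : Submodule ℂ M) := (hv.singular_pw i).mem_of_pw_mem (hX' E) hj hα
  have hvX : ∀ i, pw P i v ∈ (X : Submodule ℂ M) → v ∈ (X : Submodule ℂ M) := by
    intro i
    induction i with
    | zero => exact id
    | succ i ih =>
      intro h
      refine ih ((Submodule.smul_mem_iff _ (hv.lowerCoeff_ne_zero hc i)).1 ?_)
      rw [← hv.lower_pw_succ, lower]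
      exact sub_mem (Submodule.smul_mem _ _ (hX' _ _ h)) (hX' _ _ (hX' _ _ h))
  have hle : hv.span ≤ X := by
    refine Submodule.span_le.2 ?_
    rintro _ ⟨α, rfl⟩
    exact pw_mem (hX' F) _ (pw_mem (hX' P) _ (hvX i hi))
  rw [ht] at hle
  exact top_le_iff.1 hle

lemma pw_P_nilpotent (i : ℕ) : pw F (n + i + 1) (pw P i v) = 0 :=
  (hv.singular_pw i).pw_eq_zero (hv.nilpotent _) (Nat.lt_succ_self _)

/-- The `sl₂`-submodule generated by `pⁱ v`. -/
def layer (i : ℕ) : LieSubmodule ℂ sl2 M := stringSub (hv.singular_pw i) (hv.pw_P_nilpotent i)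

/-- The `sl₂`-submodule generated by `pⁱ v` is isomorphic to `L(n + i)`. -/
def layerEquiv (hc : c ≠ 0) (i : ℕ) : L (n + i) ≃ₗ⁅ℂ, sl2⁆ hv.layer i :=
  stringEquiv (hv.singular_pw i) (hv.pw_P_nilpotent i) (hv.pw_P_ne_zero hc i)

lemma iSupIndep_layer : iSupIndep hv.layer := by
  rw [← LieSubmodule.iSupIndep_toSubmodule]
  -- The layers lie in eigenspaces of the Casimir operator, with the distinct eigenvalues `(n + i)(n
  -- + i + 2)`.
  have hinj : Function.Injective fun i : ℕ => (((n + i : ℕ) : ℂ) * (((n + i : ℕ) : ℂ) + 2)) := by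
    intro i j h
    have h' : (n + i) * (n + i + 2) = (n + j) * (n + j + 2) := by
      dsimp only at h
      exact_mod_cast h
    rcases lt_trichotomy i j with hlt | rfl | hlt
    · nlinarith
    · rfl
    · nlinarith
  refine ((Module.End.eigenspaces_iSupIndep (casimir (M := M))).comp hinj).mono fun i => ?_
  refine stringSub_le _ _ fun j => ?_
  rw [Function.comp_apply, Module.End.mem_eigenspace_iff]
  exact (hv.singular_pw i).casimir_pw j

lemma isHarishChandra (hc : c ≠ 0) (ht : hv.span = ⊤) : IsHarishChandra M := by
  refine ⟨Set.range hv.layer, ?_, hv.iSupIndep_layer.sSupIndep_range, ?_, ?_⟩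
  · rintro _ ⟨i, rfl⟩
    exact ⟨isIrreducible_of_equiv (hv.layerEquiv hc i).symm (L.isIrreducible_sl2 _),
      Module.Finite.equiv (hv.layerEquiv hc i).toLinearEquiv⟩
  · rw [eq_top_iff]
    intro x _
    have hle : Submodule.span ℂ (Set.range (ladder v)) ≤
        ((sSup (Set.range hv.layer) : LieSubmodule ℂ sl2 M) : Submodule ℂ M) := by
      refine Submodule.span_le.2 ?_
      rintro _ ⟨⟨i, j⟩, rfl⟩
      have h1 : ladder v (i, j) ∈ hv.layer i :=
        pw_mem (X := (hv.layer i : Submodule ℂ M)) (fun _ => lie_mem_F _) j (mem_stringSub _ _)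
      exact (le_sSup ⟨i, rfl⟩ : hv.layer i ≤ sSup (Set.range hv.layer)) h1
    exact hle (hv.mem_span_ladder ht x)
  · rintro _ ⟨i, rfl⟩
    refine (Set.finite_singleton (hv.layer i)).subset ?_
    rintro _ ⟨⟨i', rfl⟩, ⟨f⟩⟩
    -- Isomorphic layers have equal dimensions `n + i + 1`, so each type occurs once.
    have h := (((hv.layerEquiv hc i').toLinearEquiv.trans f.toLinearEquiv).trans
      (hv.layerEquiv hc i).symm.toLinearEquiv).finrank_eq
    rw [L.finrank, L.finrank] at h
    have : i' = i := by omega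
    rw [this]
    rfl

lemma linearIndependent (hc : c ≠ 0) :
    LinearIndependent ℂ fun α : {α : ℕ × ℕ // α.2 ≤ n + α.1} => ladder v α.1 :=
  Module.End.eigenvectors_linearIndependent' diagOp
    (fun α : {α : ℕ × ℕ // α.2 ≤ n + α.1} => diagVal ((n + α.1.1 : ℕ) : ℂ) α.1.2)
    ((diagVal_injective n).comp Subtype.val_injective) _
    (fun α => ⟨Module.End.mem_eigenspace_iff.2 (hv.diagOp_ladder α.1), hv.ladder_ne_zero hc α.2⟩)

/-- The basis of the nonzero vectors `fʲ pⁱ v`. -/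
def basis (hc : c ≠ 0) (ht : hv.span = ⊤) : Module.Basis {α : ℕ × ℕ // α.2 ≤ n + α.1} ℂ M :=
  Module.Basis.mk (hv.linearIndependent hc) (by
    intro x _
    refine (Submodule.span_le.2 ?_) (hv.mem_span_ladder ht x)
    rintro _ ⟨⟨i, j⟩, rfl⟩
    by_cases h : j ≤ n + i
    · exact Submodule.subset_span ⟨⟨(i, j), h⟩, rfl⟩
    · rw [hv.ladder_eq_zero (by omega)]
      exact zero_mem _)

lemma basis_apply (hc : c ≠ 0) (ht : hv.span = ⊤) (α : {α : ℕ × ℕ // α.2 ≤ n + α.1}) :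
    hv.basis hc ht α = ladder v α.1 := by
  simp [basis]

/-- Two modules generated by such vectors, of the same weight and central charge, are isomorphic. -/
lemma nonempty_equiv (hc : c ≠ 0) (ht : hv.span = ⊤) {M' : Type*} [AddCommGroup M'] [Module ℂ M']
    [LieRingModule Schrodinger M'] [LieModule ℂ Schrodinger M'] {v' : M'} (hv' : IsBottom v' n c)
    (ht' : hv'.span = ⊤) : Nonempty (M ≃ₗ⁅ℂ, Schrodinger⁆ M') := by
  -- Matching the two bases is equivariant because the structure constants involve only `n`, `c` and
  -- the indices.
  let φ : M ≃ₗ[ℂ] M' := (hv.basis hc ht).equiv (hv'.basis hc ht') (Equiv.refl _)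
  have hφ : ∀ i j, φ (ladder v (i, j)) = ladder v' (i, j) := by
    intro i j
    by_cases h : j ≤ n + i
    · have := (hv.basis hc ht).equiv_apply ⟨(i, j), h⟩ (hv'.basis hc ht') (Equiv.refl _)
      rwa [basis_apply, basis_apply] at this
    · rw [hv.ladder_eq_zero (by omega), hv'.ladder_eq_zero (by omega), map_zero]
  have key : ∀ y : Schrodinger, (∀ i j, φ ⁅y, ladder v (i, j)⁆ = ⁅y, ladder v' (i, j)⁆) →
      ∀ x, φ ⁅y, x⁆ = ⁅y, φ x⁆ := by
    intro y hy x
    induction hv.mem_span_ladder ht x using Submodule.span_induction with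
    | mem x hx =>
      obtain ⟨⟨i, j⟩, rfl⟩ := hx
      rw [hy, hφ]
    | zero => simp
    | add a b _ _ ha hb => rw [lie_add, map_add, ha, hb, map_add, lie_add]
    | smul t a _ ha => rw [lie_smul, map_smul, ha, map_smul, lie_smul]
  have hQ : ∀ i j, φ ⁅Q, ladder v (i, j)⁆ = ⁅Q, ladder v' (i, j)⁆ := by
    intro i j
    rw [hv.Q_ladder, hv'.Q_ladder, map_smul, map_add, map_smul, hφ, hφ]
  refine ⟨{ φ with map_lie' := ?_ }⟩
  intro y x
  change φ ⁅y, x⁆ = ⁅y, φ x⁆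
  rw [eq_sum y]
  simp only [add_lie, smul_lie, map_add, map_smul]
  rw [key E, key H, key F, key P, key Q hQ, key Z]
  · intro i j
    rw [hv.charge, hv'.charge, map_smul, hφ]
  · intro i j
    rw [hv.P_ladder, hv'.P_ladder, map_sub, map_smul, hφ, hQ]
  · intro i j
    rw [F_ladder, F_ladder, hφ]
  · intro i j
    rw [hv.H_ladder, hv'.H_ladder, map_smul, hφ]
  · intro i j
    rw [hv.E_ladder, hv'.E_ladder, map_smul, hφ]

end IsBottom

end Rep

lemma L.isHarishChandra (n : ℕ) : IsHarishChandra (L n) := by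
  let f : (⊤ : LieSubmodule ℂ sl2 (L n)) ≃ₗ⁅ℂ, sl2⁆ L n := LieModuleEquiv.ofTop ℂ sl2 (L n)
  refine ⟨{⊤}, ?_, sSupIndep_singleton _, sSup_singleton, ?_⟩
  · rintro _ rfl
    exact ⟨isIrreducible_of_equiv f (L.isIrreducible_sl2 n),
      Module.Finite.equiv f.symm.toLinearEquiv⟩
  · intro W _
    exact (Set.finite_singleton ⊤).subset fun W' h => h.1

/-! ### Simple Harish-Chandra modules: central charge and bottom vector -/

section Rep

variable {M : Type*} [AddCommGroup M] [Module ℂ M] [LieRingModule Schrodinger M]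
  [LieModule ℂ Schrodinger M]

variable (M) in
/-- The vectors annihilated by a power of `f`. -/
def fNilpotent : Submodule ℂ M where
  carrier := {x | ∃ k, pw F k x = 0}
  add_mem' := by
    rintro x y ⟨k, hk⟩ ⟨l, hl⟩
    exact ⟨k + l, by rw [map_add, pw_eq_zero_of_le (Nat.le_add_right k l) hk,
      pw_eq_zero_of_le (Nat.le_add_left l k) hl, add_zero]⟩
  zero_mem' := ⟨0, map_zero _⟩
  smul_mem' := by
    rintro t x ⟨k, hk⟩
    exact ⟨k, by rw [map_smul, hk, smul_zero]⟩

lemma exists_finsupp_sum_eq {S : Set (LieSubmodule ℂ sl2 M)} (hS : sSup S = ⊤) (x : M) :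
    ∃ g : S →₀ M, (∀ i : S, g i ∈ (i : LieSubmodule ℂ sl2 M)) ∧ ∑ i ∈ g.support, g i = x := by
  have hx : x ∈ ⨆ i : S, ((i : LieSubmodule ℂ sl2 M) : Submodule ℂ M) := by
    rw [← LieSubmodule.iSup_toSubmodule, ← sSup_eq_iSup', hS]
    exact LieSubmodule.mem_top x
  obtain ⟨g, hg, hx⟩ := (Submodule.mem_iSup_iff_exists_finsupp _ x).1 hx
  exact ⟨g, hg, hx⟩

lemma IsHarishChandra.nilpotent (h : IsHarishChandra M) (x : M) : ∃ k, pw F k x = 0 := by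
  obtain ⟨S, hS, -, htop, -⟩ := h
  obtain ⟨g, hg, rfl⟩ := exists_finsupp_sum_eq htop x
  change _ ∈ fNilpotent M
  refine Submodule.sum_mem _ fun W _ => ?_
  obtain ⟨n, v, hvW, hv0, hv, hf⟩ := exists_singular_of_irreducible W.1 (hS W W.2).1 (hS W W.2).2
  have h1 := eq_stringSub (hS W W.2).1 hvW hv0 hv hf
  have h2 : g W ∈ stringSub hv hf := h1 ▸ hg W
  refine stringSub_le (X := fNilpotent M) hv hf (fun j => ⟨n + 1, ?_⟩) h2
  rw [← pw_add, add_comm, pw_add, hf, map_zero]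

variable (M) in
/-- The singular vectors of weight `n`. -/
def singular (n : ℕ) : Submodule ℂ M where
  carrier := {x | IsSingular x n}
  add_mem' := fun {x y} hx hy => ⟨by rw [lie_add, hx.e, hy.e, add_zero],
    by rw [lie_add, hx.h, hy.h, smul_add]⟩
  zero_mem' := ⟨lie_zero _, by rw [lie_zero, smul_zero]⟩
  smul_mem' := fun t _ hx => hx.smul t

/-- The nonzero components of a singular vector of weight `n` in the simple summands are again
singular of weight `n`, so these summands are copies of `L(n)`, of which there are finitely many. -/
lemma IsHarishChandra.finiteDimensional_singular (h : IsHarishChandra M) (n : ℕ) :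
    FiniteDimensional ℂ (singular M n) := by
  have hnil := h.nilpotent
  obtain ⟨S, hS, hind, htop, hfin⟩ := h
  let T : Set (LieSubmodule ℂ sl2 M) := {W ∈ S | Nonempty (W ≃ₗ⁅ℂ, sl2⁆ L n)}
  have hT : T.Finite := by
    rcases T.eq_empty_or_nonempty with h0 | ⟨W, hW, ⟨f⟩⟩
    · rw [h0]; exact Set.finite_empty
    · refine (hfin W hW).subset ?_
      rintro W' ⟨hW', ⟨f'⟩⟩
      exact ⟨hW', ⟨f'.trans f.symm⟩⟩
  have hfd : ∀ W : LieSubmodule ℂ sl2 M, W ∈ hT.toFinset →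
      FiniteDimensional ℂ (W : Submodule ℂ M) := fun W hW => (hS W ((hT.mem_toFinset.1 hW).1)).2
  have hfd' : FiniteDimensional ℂ
      (⨆ W : hT.toFinset, ((W : LieSubmodule ℂ sl2 M) : Submodule ℂ M) : Submodule ℂ M) :=
    @Submodule.finiteDimensional_iSup _ _ _ _ _ _ _
      (fun W : hT.toFinset => ((W : LieSubmodule ℂ sl2 M) : Submodule ℂ M)) (fun W => hfd W W.2)
  refine Submodule.finiteDimensional_of_le (S₂ := ⨆ W : hT.toFinset,
    ((W : LieSubmodule ℂ sl2 M) : Submodule ℂ M)) fun x hx => ?_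
  obtain ⟨g, hg, rfl⟩ := exists_finsupp_sum_eq htop x
  have hx' : IsSingular (∑ i ∈ g.support, g i) n := hx
  rw [sSupIndep_iff, ← LieSubmodule.iSupIndep_toSubmodule,
    iSupIndep_iff_finsetSum_eq_zero_imp_eq_zero] at hind
  -- The sum is direct and its summands are stable, so `e` and `h - n` annihilate each component
  -- separately.
  have hE := hind g.support (fun i => ⁅E, g i⁆) (fun i _ => lie_mem_E _ (hg i))
    (by rw [← lie_sum]; exact hx'.e)
  have hH := hind g.support (fun i => ⁅H, g i⁆ - (n : ℂ) • g i)
    (fun i _ => sub_mem (lie_mem_H _ (hg i)) (Submodule.smul_mem _ _ (hg i)))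
    (by rw [Finset.sum_sub_distrib, ← lie_sum, ← Finset.smul_sum, hx'.h, sub_self])
  refine Submodule.sum_mem _ fun W hW => ?_
  have hs : IsSingular (g W) n := ⟨hE W hW, sub_eq_zero.1 (hH W hW)⟩
  have hf := hs.pw_eq_zero (hnil _) (Nat.lt_succ_self n)
  have h0 : g W ≠ 0 := Finsupp.mem_support_iff.1 hW
  have heq := eq_stringSub (hS W W.2).1 (hg W) h0 hs hf
  have hWT : (W : LieSubmodule ℂ sl2 M) ∈ hT.toFinset := by
    rw [hT.mem_toFinset]
    exact ⟨W.2, heq ▸ ⟨(stringEquiv hs hf h0).symm⟩⟩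
  exact Submodule.mem_iSup_of_mem
    (p := fun W : hT.toFinset => ((W : LieSubmodule ℂ sl2 M) : Submodule ℂ M)) ⟨W, hWT⟩ (hg W)

lemma IsHarishChandra.exists_isMinimalType [Nontrivial M] (h : IsHarishChandra M) :
    ∃ n, IsMinimalType M n := by
  classical
  have hex : ∃ n, IsType M n := by
    obtain ⟨S, hS, -, htop, -⟩ := h
    obtain ⟨x, hx⟩ := exists_ne (0 : M)
    obtain ⟨g, hg, rfl⟩ := exists_finsupp_sum_eq htop x
    obtain ⟨W, -, -⟩ := Finset.exists_ne_zero_of_sum_ne_zero hx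
    obtain ⟨n, v, -, hv0, hv, hf⟩ :=
      exists_singular_of_irreducible W.1 (hS W W.2).1 (hS W W.2).2
    exact ⟨n, isType_of_isSingular hv hf hv0⟩
  exact ⟨Nat.find hex, Nat.find_spec hex, fun m hm => Nat.find_min' hex hm⟩

/-- Schur's argument: `z` preserves the nonzero finite-dimensional space of singular vectors of the
minimal weight, hence has an eigenvector there, and the eigenspaces of `z` in the whole module are
submodules. -/
lemma IsHarishChandra.exists_hasCentralCharge (hM : LieModule.IsIrreducible ℂ Schrodinger M)
    (h : IsHarishChandra M) : ∃ c, HasCentralCharge M c := by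
  have : Nontrivial M := LieModule.nontrivial_of_isIrreducible ℂ Schrodinger M
  obtain ⟨n, hn, -⟩ := h.exists_isMinimalType
  obtain ⟨v, hv0, hv⟩ := hn.exists_isSingular
  have := h.finiteDimensional_singular n
  have : Nontrivial (singular M n) := ⟨⟨v, hv⟩, 0, fun h => hv0 (congrArg Subtype.val h)⟩
  have hZ : ∀ x ∈ singular M n, LieModule.toEnd ℂ Schrodinger M Z x ∈ singular M n := by
    intro x hx
    have hx' : IsSingular x n := hx
    exact ⟨by rw [LieModule.toEnd_apply_apply, lie_Z_comm, hx'.e, lie_zero],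
      by rw [LieModule.toEnd_apply_apply, lie_Z_comm, hx'.h, lie_smul]⟩
  obtain ⟨c, hc⟩ := Module.End.exists_eigenvalue ((LieModule.toEnd ℂ Schrodinger M Z).restrict hZ)
  obtain ⟨w, hw⟩ := hc.exists_hasEigenvector
  let X : LieSubmodule ℂ Schrodinger M :=
    { Module.End.eigenspace (LieModule.toEnd ℂ Schrodinger M Z) c with
      lie_mem := fun {y x} hx => by
        have hx' : ⁅Z, x⁆ = c • x := Module.End.mem_eigenspace_iff.1 hx
        refine Module.End.mem_eigenspace_iff.2 ?_
        rw [LieModule.toEnd_apply_apply, ← lie_Z_comm, hx', lie_smul] }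
  have hwX : (w : M) ∈ X :=
    Module.End.mem_eigenspace_iff.2 (congrArg Subtype.val hw.apply_eq_smul)
  have hX : X = ⊤ := lieSubmodule_eq_top hM fun h0 =>
    hw.2 (Subtype.ext ((LieSubmodule.eq_bot_iff _).1 h0 _ hwX))
  refine ⟨c, fun x => ?_⟩
  have hx : x ∈ X := hX ▸ LieSubmodule.mem_top x
  exact Module.End.mem_eigenspace_iff.1 hx

lemma HasCentralCharge.unique [Nontrivial M] {c c' : ℂ} (h : HasCentralCharge M c)
    (h' : HasCentralCharge M c') : c = c' := by
  obtain ⟨x, hx⟩ := exists_ne (0 : M)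
  exact smul_left_injective ℂ hx ((h x).symm.trans (h' x))

/-- The highest weight vectors of the minimal type are annihilated by the lowering operator. -/
lemma IsHarishChandra.exists_isBottom (h : IsHarishChandra M) {n : ℕ} (hn : IsMinimalType M n)
    {c : ℂ} (hc : HasCentralCharge M c) : ∃ v : M, IsBottom v n c := by
  obtain ⟨v, hv0, hv⟩ := IsType.exists_isSingular hn.1
  refine ⟨v, hv0, hv, ?_, hc, h.nilpotent⟩
  -- A nonzero lowered vector would be singular of weight `n - 1`, giving a type below the minimal
  -- one.
  by_contra hne
  obtain ⟨m, hm⟩ := hv.lower.exists_nat hne (h.nilpotent _)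
  have hs := hv.lower
  rw [hm] at hs
  have h1 : n ≤ m := hn.2 (isType_of_isSingular hs
    (hs.pw_eq_zero (h.nilpotent _) (Nat.lt_succ_self m)) hne)
  rw [sub_eq_iff_eq_add] at hm
  have : n = m + 1 := by exact_mod_cast hm
  omega

/-- An irreducible module of central charge zero is isomorphic to `L(n)`. -/
lemma IsBottom.nonempty_equiv_L {v : M} {n : ℕ} (hM : LieModule.IsIrreducible ℂ Schrodinger M)
    (hv : IsBottom v n 0) : Nonempty (M ≃ₗ⁅ℂ, Schrodinger⁆ L n) := by
  have hP : ⁅P, v⁆ = 0 := by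
    by_contra hne
    -- All lowering coefficients vanish for charge zero, so `p v` is itself a bottom vector. It
    -- would generate the simple module, where no singular vector has weight below `n + 1`; but `v`
    -- has weight `n`.
    have hb : IsBottom ⁅P, v⁆ (n + 1) 0 := by
      refine ⟨hne, by simpa using hv.singular.lie_P, ?_, hv.charge, hv.nilpotent⟩
      have := hv.lower_pw 1
      rw [pw_succ, pw_zero] at this
      rw [this, lowerCoeff]
      simp
    have := hb.le_of_isSingular (hb.span_eq_top hM) hv.ne_zero hv.singular
    omega
  have hPi : ∀ i, pw P (i + 1) v = 0 := fun i => by rw [pw_succ', hP, map_zero]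
  have hladder : ∀ i j, ladder v (i + 1, j) = 0 := fun i j => by
    rw [ladder, hPi, map_zero]
  have hzero : ∀ y : Schrodinger, (∀ i j, ⁅y, ladder v (i, j)⁆ = 0) → ∀ x : M, ⁅y, x⁆ = 0 := by
    intro y hy x
    induction hv.mem_span_ladder (hv.span_eq_top hM) x using Submodule.span_induction with
    | mem x hx =>
      obtain ⟨⟨i, j⟩, rfl⟩ := hx
      exact hy i j
    | zero => exact lie_zero y
    | add a b _ _ ha hb => rw [lie_add, ha, hb, add_zero]
    | smul t a _ ha => rw [lie_smul, ha, smul_zero]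
  have hQ : ∀ x : M, ⁅Q, x⁆ = 0 := hzero Q fun i j => by
    rw [hv.Q_ladder, hladder, lowerCoeff]
    simp
  have hP : ∀ x : M, ⁅P, x⁆ = 0 := hzero P fun i j => by
    rw [hv.P_ladder, hladder, hQ, smul_zero, sub_zero]
  have hf := hv.singular.pw_eq_zero (hv.nilpotent _) (Nat.lt_succ_self n)
  have hbij : Function.Bijective (stringMap n v) := by
    refine ⟨stringHom_injective hv.singular hf hv.ne_zero, fun x => ?_⟩
    have hx : x ∈ stringSub hv.singular hf := by
      refine (Submodule.span_le (p := (stringSub hv.singular hf : Submodule ℂ M)).2 ?_)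
        (hv.mem_span_ladder (hv.span_eq_top hM) x)
      rintro _ ⟨⟨i, j⟩, rfl⟩
      rcases i with _ | i
      · exact pw_mem (X := (stringSub hv.singular hf : Submodule ℂ M)) (fun _ => lie_mem_F _) j
          (mem_stringSub _ _)
      · rw [hladder]; exact zero_mem _
    exact (LieModuleHom.mem_range _ _).1 hx
  have hL : ∀ (y : Schrodinger), y.e = 0 → y.h = 0 → y.f = 0 → ∀ x : L n, ⁅y, x⁆ = 0 := by
    intro y h1 h2 h3 x
    ext k hk
    rw [L.coord_lie _ _ _ hk, h1, h2, h3]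
    simp
  refine ⟨LieModuleEquiv.symm { LinearEquiv.ofBijective (stringMap n v) hbij with map_lie' := ?_ }⟩
  intro y x
  change stringMap n v ⁅y, x⁆ = ⁅y, stringMap n v x⁆
  rw [eq_sum y]
  simp only [add_lie, smul_lie, map_add, map_smul, stringMap_E hv.singular,
    stringMap_H hv.singular, stringMap_F hf]
  rw [hP, hQ, hv.charge, hL P rfl rfl rfl, hL Q rfl rfl rfl, hL Z rfl rfl rfl]
  simp

end Rep

/-! ### Complete reducibility over `sl₂` and a criterion for generation -/

section Rep

variable {M : Type*} [AddCommGroup M] [Module ℂ M] [LieRingModule Schrodinger M]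
  [LieModule ℂ Schrodinger M]

/-- If `f` is locally nilpotent, `f x` is zero and `x` has weight `-m - 2`, then `x` vanishes. -/
lemma eq_zero_of_lie_F_lie_E (hf : ∀ x : M, ∃ k, pw F k x = 0) {x : M} {m : ℕ}
    (hH : ⁅H, x⁆ = (-(m : ℂ) - 2) • x) (hx : ⁅F, ⁅E, x⁆⁆ = 0) : x = 0 := by
  -- The factor `(r + 1)(m + 2 + r)` is never zero, so no power of `f` could kill a nonzero `x`.
  have key : ∀ r : ℕ, ⁅E, pw F (r + 1) x⁆ = (-((r + 1 : ℂ) * (m + 2 + r))) • pw F r x := by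
    intro r
    induction r with
    | zero => rw [pw_succ, pw_zero, E_F, hx, hH]; push_cast; module
    | succ r ih =>
      rw [pw_succ, E_F, ih, lie_smul, ← pw_succ, H_pw_F hH]; push_cast; module
  by_contra hne
  obtain ⟨r, h1, h2⟩ := Nat.exists_not_and_succ_of_not_zero_of_exists
    (p := fun k => pw F k x = 0) (by simpa using hne) (hf x)
  have := key r
  rw [h2, lie_zero, eq_comm, smul_eq_zero_iff_left h1, neg_eq_zero, mul_eq_zero] at this
  rcases this with h | h
  · exact Nat.cast_add_one_ne_zero r h
  · have h' : ((m + 2 + r : ℕ) : ℂ) = 0 := by push_cast; exact h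
    rw [Nat.cast_eq_zero] at h'
    omega

/-- Complete reducibility: if `f` is locally nilpotent, a weight vector annihilated by a power of
`e` is a sum of vectors `fʲ y` with `y` singular. -/
lemma exists_sum_pw_F (hf : ∀ x : M, ∃ k, pw F k x = 0) (k : ℕ) : ∀ {x : M} {μ : ℂ},
    ⁅H, x⁆ = μ • x → pw E k x = 0 → ∃ y : ℕ → M, (∀ j, IsSingular (y j) (μ + 2 * j)) ∧
      x = ∑ j ∈ Finset.range k, pw F j (y j) := by
  induction k with
  | zero =>
    intro x μ _ hE
    exact ⟨fun _ => 0, fun _ => ⟨lie_zero _, by rw [lie_zero, smul_zero]⟩, by simpa using hE⟩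
  | succ k ih =>
    intro x μ hH hE
    obtain ⟨y, hy, hsum⟩ := ih (x := ⁅E, x⁆) (μ := μ + 2)
      (by rw [H_E, hH, lie_smul]; module) (by rw [← pw_succ']; exact hE)
    -- By `hEF` below, this scalar makes `e` send `t j • fʲ⁺¹ (y j)` back to `fʲ (y j)`. It takes
    -- the default value `0` when `μ + 2 + j = 0`, a case treated separately.
    let t : ℕ → ℂ := fun j => ((j + 1) * (μ + 2 + j))⁻¹
    let x' : M := x - ∑ j ∈ Finset.range k, t j • pw F (j + 1) (y j)
    have hEF : ∀ j, ⁅E, pw F (j + 1) (y j)⁆ = ((j + 1) * (μ + 2 + j)) • pw F j (y j) := by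
      intro j
      rw [(hy j).E_pw]
      congr 1
      ring
    have hH' : ⁅H, x'⁆ = μ • x' := by
      simp only [x', lie_sub, lie_sum, lie_smul, hH, smul_sub, Finset.smul_sum]
      congr 1
      refine Finset.sum_congr rfl fun j _ => ?_
      rw [H_pw_F (hy j).h]
      push_cast
      module
    have hE' : ⁅E, x'⁆ = ∑ j ∈ Finset.range k,
        (1 - t j * ((j + 1) * (μ + 2 + j))) • pw F j (y j) := by
      simp only [x', lie_sub, lie_sum, lie_smul, hEF]
      rw [hsum, ← Finset.sum_sub_distrib]
      refine Finset.sum_congr rfl fun j _ => ?_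
      module
    have ht : ∀ j : ℕ, μ + 2 + j ≠ 0 → 1 - t j * ((j + 1) * (μ + 2 + j)) = 0 := fun j hj => by
      rw [sub_eq_zero, eq_comm]
      exact inv_mul_cancel₀ (mul_ne_zero (Nat.cast_add_one_ne_zero j) hj)
    have hx' : ⁅E, x'⁆ = 0 := by
      by_cases h : ∃ j : ℕ, μ + 2 + j = 0
      · obtain ⟨m, hm⟩ := h
        have hμ : μ = -(m : ℂ) - 2 := by linear_combination hm
        have hm' : IsSingular (y m) (m : ℂ) := by
          have := hy m
          rwa [show μ + 2 + 2 * (m : ℂ) = m by linear_combination hm] at this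
        have hFE : ⁅F, ⁅E, x'⁆⁆ = 0 := by
          rw [hE', lie_sum]
          refine Finset.sum_eq_zero fun j _ => ?_
          rw [lie_smul, ← pw_succ]
          by_cases hj : j = m
          · rw [hj, hm'.pw_eq_zero (hf _) (Nat.lt_succ_self m), smul_zero]
          · rw [ht j fun h => hj ?_, zero_smul]
            have : (j : ℂ) = m := by linear_combination h - hm
            exact_mod_cast this
        rw [eq_zero_of_lie_F_lie_E hf (hμ ▸ hH') hFE, lie_zero]
      · rw [hE']
        refine Finset.sum_eq_zero fun j _ => ?_
        rw [ht j fun hj => h ⟨j, hj⟩, zero_smul]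
    refine ⟨fun j => if j = 0 then x' else t (j - 1) • y (j - 1), fun j => ?_, ?_⟩
    · rcases j with _ | j
      · simp only [if_true]
        exact ⟨hx', by simpa using hH'⟩
      · simp only [Nat.succ_ne_zero, if_false, Nat.add_sub_cancel]
        have := (hy j).smul (t j)
        convert this using 1
        push_cast
        ring
    · rw [Finset.sum_range_succ']
      simp only [Nat.succ_ne_zero, if_false, Nat.add_sub_cancel, if_true, map_smul, pw_zero]
      rw [add_sub_cancel]

/-- If `M` is spanned by weight vectors annihilated by powers of `e`, and singular vectors of the
same weight are proportional, then `M` is generated by `v`. -/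
lemma IsBottom.span_eq_top_of_singular {v : M} {n : ℕ} {c : ℂ} (hv : IsBottom v n c) (hc : c ≠ 0)
    (hspan : Submodule.span ℂ {x : M | (∃ μ : ℂ, ⁅H, x⁆ = μ • x) ∧ ∃ k, pw E k x = 0} = ⊤)
    (huniq : ∀ (m : ℕ) (x y : M), IsSingular x m → IsSingular y m → x ≠ 0 → ∃ t : ℂ, y = t • x) :
    hv.span = ⊤ := by
  classical
  have hex : ∃ m : ℕ, ∃ x : M, x ≠ 0 ∧ IsSingular x m := ⟨n, v, hv.ne_zero, hv.singular⟩
  obtain ⟨w, hw0, hw⟩ := Nat.find_spec hex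
  have hmin : ∀ {m : ℕ} {x : M}, x ≠ 0 → IsSingular x m → Nat.find hex ≤ m :=
    fun h0 h => Nat.find_min' hex ⟨_, h0, h⟩
  generalize Nat.find hex = m at hw hmin
  -- A singular vector of least weight is killed by the lowering operator.
  have hwb : IsBottom w m c := by
    refine ⟨hw0, hw, ?_, hv.charge, hv.nilpotent⟩
    by_contra hne
    obtain ⟨l, hl⟩ := hw.lower.exists_nat hne (hv.nilpotent _)
    have h1 := hmin hne (hl ▸ hw.lower)
    rw [sub_eq_iff_eq_add] at hl
    have : m = l + 1 := by exact_mod_cast hl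
    omega
  -- If `m < n`, uniqueness makes `v` a nonzero multiple of `pⁿ⁻ᵐ w`, which the lowering operator
  -- does not kill.
  have hmn : m = n := by
    obtain ⟨i, hi⟩ := Nat.exists_eq_add_of_le (hmin hv.ne_zero hv.singular)
    rcases i with _ | i
    · omega
    have hs := hv.singular
    rw [hi] at hs
    obtain ⟨t, ht⟩ := huniq _ _ _ (hwb.singular_pw (i + 1)) hs (hwb.pw_P_ne_zero hc _)
    have h1 := hwb.lower_pw_succ i
    have h2 := hv.lower_eq_zero
    rw [ht, hi] at h2
    have h3 : lower ((m + (i + 1) : ℕ) : ℂ) (t • pw P (i + 1) w) =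
        t • lower ((m + (i + 1) : ℕ) : ℂ) (pw P (i + 1) w) := by
      simp only [lower, lie_smul, smul_sub, smul_comm t]
    rw [h3, h1, smul_eq_zero, smul_eq_zero] at h2
    rcases h2 with h | h | h
    · exact absurd (by rw [ht, h, zero_smul]) hv.ne_zero
    · exact absurd h (hwb.lowerCoeff_ne_zero hc i)
    · exact absurd h (hwb.pw_P_ne_zero hc i)
  subst hmn
  rw [← LieSubmodule.toSubmodule_inj, LieSubmodule.top_toSubmodule, eq_top_iff, ← hspan,
    Submodule.span_le]
  rintro x ⟨⟨μ, hμ⟩, k, hk⟩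
  -- Each nonzero singular component has some weight `n + i`, so by uniqueness it is a multiple of
  -- `pⁱ v`.
  obtain ⟨y, hy, rfl⟩ := exists_sum_pw_F hv.nilpotent k hμ hk
  refine Submodule.sum_mem _ fun j _ => ?_
  refine pw_mem (fun _ => hv.span.lie_mem) j ?_
  by_cases h0 : y j = 0
  · rw [h0]; exact zero_mem _
  have hs := hy j
  obtain ⟨l, hl⟩ := hs.exists_nat h0 (hv.nilpotent _)
  rw [hl] at hs
  obtain ⟨i, rfl⟩ := Nat.exists_eq_add_of_le (hmin h0 hs)
  obtain ⟨t, ht⟩ := huniq _ _ _ (hv.singular_pw i) hs (hv.pw_P_ne_zero hc i)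
  rw [ht]
  exact Submodule.smul_mem _ _ (hv.mem_span (i, 0))

end Rep

/-! ### Formal sums as a model for the Verma module -/

lemma subalgebra_eq_top {S : Subalgebra ℂ U} (h : ∀ x, toU x ∈ S) : S = ⊤ := by
  have hind : ∀ t : TensorAlgebra ℂ Schrodinger,
      UniversalEnvelopingAlgebra.mkAlgHom ℂ Schrodinger t ∈ S := by
    intro t
    induction t using TensorAlgebra.induction with
    | algebraMap r =>
      rw [AlgHom.commutes]
      exact Subalgebra.algebraMap_mem _ r
    | ι x => exact h x
    | mul u v hu hv => rw [map_mul]; exact Subalgebra.mul_mem _ hu hv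
    | add u v hu hv => rw [map_add]; exact Subalgebra.add_mem _ hu hv
  refine Algebra.eq_top_iff.2 fun u => ?_
  obtain ⟨t, rfl⟩ : ∃ t, UniversalEnvelopingAlgebra.mkAlgHom ℂ Schrodinger t = u :=
    RingCon.mkₐ_surjective _ u
  exact hind t

lemma smul_mem_of_toU_smul_mem {M : Type*} [AddCommGroup M] [Module U M] [Module ℂ M]
    [IsScalarTower ℂ U M] {N : Submodule ℂ M} (h : ∀ (x : Schrodinger), ∀ m ∈ N, toU x • m ∈ N)
    (u : U) {m : M} (hm : m ∈ N) : u • m ∈ N := by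
  let S : Subalgebra ℂ U :=
    { carrier := {u | ∀ m ∈ N, u • m ∈ N}
      mul_mem' := fun {u w} hu hw m hm => by rw [mul_smul]; exact hu _ (hw _ hm)
      add_mem' := fun {u w} hu hw m hm => by rw [add_smul]; exact N.add_mem (hu _ hm) (hw _ hm)
      algebraMap_mem' := fun r m hm => by
        rw [algebraMap_smul]; exact N.smul_mem r hm }
  have hS : S = ⊤ := subalgebra_eq_top h
  have hu : u ∈ S := hS ▸ Algebra.mem_top
  exact hu m hm

/-- Formal sums `∑ g i j fⁱ qʲ v` over all integers `i` and `j`, with the action of the Schrödinger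
algebra that extends the one on the Verma module with highest weight `a` and central
charge `c`. -/
def FormalSum (_a _c : ℂ) : Type := ℤ → ℤ → ℂ

namespace FormalSum

variable (a c : ℂ)

instance : AddCommGroup (FormalSum a c) := inferInstanceAs (AddCommGroup (ℤ → ℤ → ℂ))
instance : Module ℂ (FormalSum a c) := inferInstanceAs (Module ℂ (ℤ → ℤ → ℂ))

/-- These are the coefficients resulting from `e fⁱ qʲ v = i (a - j - i + 1) fⁱ⁻¹ qʲ v + c j (j - 1)
/ 2 fⁱ qʲ⁻² v` and `p fⁱ qʲ v = -i fⁱ⁻¹ qʲ⁺¹ v + c j fⁱ qʲ⁻¹ v`. Each coefficient involves finitely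
many entries, so no finiteness of the sum is needed. -/
instance : Bracket Schrodinger (FormalSum a c) :=
  ⟨fun x g i j =>
    x.e * ((i + 1) * (a - j - i) * g (i + 1) j + c * ((j + 2) * (j + 1) / 2) * g i (j + 2))
    + x.h * ((a - 2 * i - j) * g i j)
    + x.f * g (i - 1) j
    + x.p * (-(i + 1) * g (i + 1) (j - 1) + c * (j + 1) * g i (j + 1))
    + x.q * g i (j - 1)
    + x.z * (c * g i j)⟩

variable {a c}

lemma add_apply (g g' : FormalSum a c) (i j : ℤ) : (g + g') i j = g i j + g' i j := rfl
lemma sub_apply (g g' : FormalSum a c) (i j : ℤ) : (g - g') i j = g i j - g' i j := rfl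
lemma smul_apply (t : ℂ) (g : FormalSum a c) (i j : ℤ) : (t • g) i j = t * g i j := rfl
lemma zero_apply (i j : ℤ) : (0 : FormalSum a c) i j = 0 := rfl
lemma sum_apply {ι : Type*} (s : Finset ι) (g : ι → FormalSum a c) (i j : ℤ) :
    (∑ k ∈ s, g k) i j = ∑ k ∈ s, g k i j := by
  classical
  induction s using Finset.induction_on with
  | empty => rfl
  | insert k s hk ih => rw [Finset.sum_insert hk, Finset.sum_insert hk, add_apply, ih]

@[ext] lemma ext {g g' : FormalSum a c} (h : ∀ i j, g i j = g' i j) : g = g' :=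
  funext fun i => funext fun j => h i j

lemma lie_apply (x : Schrodinger) (g : FormalSum a c) (i j : ℤ) : (⁅x, g⁆ : FormalSum a c) i j =
    x.e * ((i + 1) * (a - j - i) * g (i + 1) j + c * ((j + 2) * (j + 1) / 2) * g i (j + 2))
    + x.h * ((a - 2 * i - j) * g i j)
    + x.f * g (i - 1) j
    + x.p * (-(i + 1) * g (i + 1) (j - 1) + c * (j + 1) * g i (j + 1))
    + x.q * g i (j - 1)
    + x.z * (c * g i j) := rfl

instance : LieRingModule Schrodinger (FormalSum a c) where
  add_lie x y g := by
    ext i j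
    simp only [lie_apply, add_apply, add_e, add_h, add_f, add_p, add_q, add_z]
    ring
  lie_add x g g' := by
    ext i j
    simp only [lie_apply, add_apply]
    ring
  leibniz_lie x y g := by
    ext i j
    simp only [lie_apply, add_apply, lie_e, lie_h, lie_f, lie_p, lie_q, lie_z]
    have h1 : ∀ k : ℤ, k + 1 - 1 = k := fun k => by ring
    have h2 : ∀ k : ℤ, k - 1 + 1 = k := fun k => by ring
    have h3 : ∀ k : ℤ, k + 2 - 1 = k + 1 := fun k => by ring
    have h4 : ∀ k : ℤ, k - 1 + 2 = k + 1 := fun k => by ring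
    have h5 : ∀ k : ℤ, k + 2 + 1 = k + 1 + 2 := fun k => by ring
    simp only [h1, h2, h3, h4, h5]
    push_cast
    ring

instance : LieModule ℂ Schrodinger (FormalSum a c) where
  smul_lie t x g := by
    ext i j
    simp only [lie_apply, smul_apply, smul_e, smul_h, smul_f, smul_p, smul_q, smul_z]
    ring
  lie_smul t x g := by
    ext i j
    simp only [lie_apply, smul_apply]
    ring

variable (a c) in
/-- The action of the enveloping algebra. -/
def rep : U →ₐ[ℂ] Module.End ℂ (FormalSum a c) :=
  UniversalEnvelopingAlgebra.lift ℂ (LieModule.toEnd ℂ Schrodinger (FormalSum a c))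

instance : Module U (FormalSum a c) := Module.compHom _ (rep a c).toRingHom

lemma smul_eq (u : U) (g : FormalSum a c) : u • g = rep a c u g := rfl

instance : IsScalarTower ℂ U (FormalSum a c) where
  smul_assoc t u g := by rw [smul_eq, map_smul]; rfl

lemma toU_smul (x : Schrodinger) (g : FormalSum a c) : toU x • g = ⁅x, g⁆ := by
  rw [smul_eq, rep, toU, UniversalEnvelopingAlgebra.lift_ι_apply]
  rfl

lemma F_smul_apply (g : FormalSum a c) (i j : ℤ) : (toU F • g) i j = g (i - 1) j := by
  rw [toU_smul, lie_apply]; simp [F]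

lemma Q_smul_apply (g : FormalSum a c) (i j : ℤ) : (toU Q • g) i j = g i (j - 1) := by
  rw [toU_smul, lie_apply]; simp [Q]

lemma Z_smul_apply (g : FormalSum a c) (i j : ℤ) : (toU Z • g) i j = c * g i j := by
  rw [toU_smul, lie_apply]; simp [Z]

lemma H_smul_apply (g : FormalSum a c) (i j : ℤ) :
    (toU H • g) i j = (a - 2 * i - j) * g i j := by
  rw [toU_smul, lie_apply]; simp [H]

lemma P_smul_apply (g : FormalSum a c) (i j : ℤ) : (toU P • g) i j =
    -(i + 1) * g (i + 1) (j - 1) + c * (j + 1) * g i (j + 1) := by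
  rw [toU_smul, lie_apply]; simp [P]

lemma E_smul_apply (g : FormalSum a c) (i j : ℤ) : (toU E • g) i j =
    (i + 1) * (a - j - i) * g (i + 1) j + c * ((j + 2) * (j + 1) / 2) * g i (j + 2) := by
  rw [toU_smul, lie_apply]; simp [E]

lemma F_pow_smul_apply (k : ℕ) (g : FormalSum a c) (i j : ℤ) :
    (toU F ^ k • g) i j = g (i - k) j := by
  induction k generalizing i with
  | zero => simp
  | succ k ih =>
    rw [pow_succ', mul_smul, F_smul_apply, ih]
    congr 1
    push_cast
    ring

/-- Powers of `f` shift the first index over all of `ℤ`. This lets maps into the formal sums extend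
to the localization. -/
lemma bijective_smul (s : powF) : Function.Bijective fun g : FormalSum a c => (s : U) • g := by
  obtain ⟨_, k, rfl⟩ := s
  constructor
  · intro g g' h
    ext i j
    have := congrArg (fun g : FormalSum a c => g (i + k) j) h
    simpa only [F_pow_smul_apply, add_sub_cancel_right] using this
  · intro g
    refine ⟨fun i j => g (i + k) j, ?_⟩
    ext i j
    refine (F_pow_smul_apply k _ i j).trans ?_
    rw [sub_add_cancel]

/-- The monomial `fᵏ qˡ v`. -/
def mono (k l : ℤ) : FormalSum a c := fun i j => if i = k ∧ j = l then 1 else 0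

lemma mono_apply (k l i j : ℤ) : (mono k l : FormalSum a c) i j = if i = k ∧ j = l then 1 else 0 :=
  rfl

lemma F_smul_mono (k l : ℤ) : toU F • (mono k l : FormalSum a c) = mono (k + 1) l := by
  ext i j
  simp only [F_smul_apply, mono_apply, sub_eq_iff_eq_add]

lemma Q_smul_mono (k l : ℤ) : toU Q • (mono k l : FormalSum a c) = mono k (l + 1) := by
  ext i j
  simp only [Q_smul_apply, mono_apply, sub_eq_iff_eq_add]

variable (a c) in
/-- The homomorphism from the Verma module. -/
def ofVerma : Verma a c →ₗ[U] FormalSum a c :=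
  (vermaIdeal a c).liftQ (LinearMap.toSpanSingleton U (FormalSum a c) (mono 0 0)) (by
    rw [vermaIdeal, Submodule.span_le]
    rintro x (rfl | rfl | rfl | rfl) <;>
      rw [SetLike.mem_coe, LinearMap.mem_ker, LinearMap.toSpanSingleton_apply]
    · ext i j
      rw [E_smul_apply, mono_apply, mono_apply, zero_apply]
      split_ifs with h1 h2 h2
      · omega
      · have h : (i : ℂ) + 1 = 0 := by exact_mod_cast h1.1
        simp [h]
      · have h : (j : ℂ) + 2 = 0 := by exact_mod_cast h2.2
        simp [h]
      · simp
    · ext i j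
      rw [P_smul_apply, mono_apply, mono_apply, zero_apply]
      split_ifs with h1 h2 h2
      · omega
      · have h : (i : ℂ) + 1 = 0 := by exact_mod_cast h1.1
        simp [h]
      · have h : (j : ℂ) + 1 = 0 := by exact_mod_cast h2.2
        simp [h]
      · simp
    · ext i j
      rw [sub_smul, algebraMap_smul, sub_apply, H_smul_apply, smul_apply, mono_apply, zero_apply]
      split_ifs with h
      · rw [h.1, h.2]; simp
      · simp
    · ext i j
      rw [sub_smul, algebraMap_smul, sub_apply, Z_smul_apply, smul_apply, zero_apply, sub_self])

end FormalSum

variable {a c : ℂ}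

open FormalSum

/-- The vectors `fᵏ qˡ v` of the Verma module. -/
def vermaVec (a c : ℂ) (α : ℕ × ℕ) : Verma a c :=
  toU F ^ α.1 • toU Q ^ α.2 • Submodule.Quotient.mk 1

lemma ofVerma_vermaVec (α : ℕ × ℕ) : ofVerma a c (vermaVec a c α) = mono α.1 α.2 := by
  obtain ⟨k, l⟩ := α
  have h0 : ofVerma a c (Submodule.Quotient.mk 1) = mono 0 0 := by
    change (1 : U) • mono 0 0 = _
    rw [one_smul]
  have hl : ∀ l : ℕ, toU Q ^ l • (mono 0 0 : FormalSum a c) = mono 0 l := by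
    intro l
    induction l with
    | zero => simp
    | succ l ih => rw [pow_succ', mul_smul, ih, Q_smul_mono]; push_cast; rfl
  rw [vermaVec, map_smul, map_smul, h0, hl]
  induction k with
  | zero => simp
  | succ k ih => rw [pow_succ', mul_smul, ih, F_smul_mono]; push_cast; rfl

lemma toU_comm (x y : Schrodinger) : toU x * toU y = toU y * toU x + toU ⁅x, y⁆ := by
  rw [toU_lie]; abel

/-- Move `x` to the right past the leading `f` or `q`. The commutator is again in the Lie algebra,
so the induction runs over all `x` at once and ends at the highest weight vector. -/
lemma toU_smul_vermaVec_mem (α : ℕ × ℕ) (x : Schrodinger) :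
    toU x • vermaVec a c α ∈ Submodule.span ℂ (Set.range (vermaVec a c)) := by
  have mem : ∀ k l, vermaVec a c (k, l) ∈ Submodule.span ℂ (Set.range (vermaVec a c)) :=
    fun k l => Submodule.subset_span ⟨(k, l), rfl⟩
  have hF : ∀ m ∈ Submodule.span ℂ (Set.range (vermaVec a c)),
      toU F • m ∈ Submodule.span ℂ (Set.range (vermaVec a c)) := by
    intro m hm
    refine Submodule.span_le (p := (Submodule.span ℂ (Set.range (vermaVec a c))).comap
      (Algebra.lsmul ℂ ℂ (Verma a c) (toU F))).2 ?_ hm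
    rintro _ ⟨⟨k, l⟩, rfl⟩
    have : toU F • vermaVec a c (k, l) = vermaVec a c (k + 1, l) := by
      rw [vermaVec, vermaVec, pow_succ', mul_smul]
    simp only [Submodule.comap_coe, Set.mem_preimage, Algebra.lsmul_coe, this]
    exact mem _ _
  have hcomm : Commute (toU Q) (toU F) := by
    have := toU_comm F Q
    rw [lie_F_Q, toU_zero, add_zero] at this
    exact this.symm
  have hQ : ∀ m ∈ Submodule.span ℂ (Set.range (vermaVec a c)),
      toU Q • m ∈ Submodule.span ℂ (Set.range (vermaVec a c)) := by
    intro m hm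
    refine Submodule.span_le (p := (Submodule.span ℂ (Set.range (vermaVec a c))).comap
      (Algebra.lsmul ℂ ℂ (Verma a c) (toU Q))).2 ?_ hm
    rintro _ ⟨⟨k, l⟩, rfl⟩
    have : toU Q • vermaVec a c (k, l) = vermaVec a c (k, l + 1) := by
      rw [vermaVec, vermaVec, pow_succ', ← mul_smul, (hcomm.pow_right k).eq, mul_smul, mul_smul]
    simp only [Submodule.comap_coe, Set.mem_preimage, Algebra.lsmul_coe, this]
    exact mem _ _
  obtain ⟨k, l⟩ := α
  induction k generalizing x with
  | succ k ih =>
    rw [vermaVec, pow_succ', mul_smul, ← mul_smul, toU_comm, add_smul, mul_smul]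
    exact add_mem (hF _ (ih x)) (ih _)
  | zero =>
    induction l generalizing x with
    | succ l ih =>
      have : vermaVec a c (0, l + 1) = toU Q • vermaVec a c (0, l) := by
        simp only [vermaVec, pow_zero, one_smul, pow_succ', mul_smul]
      rw [this, ← mul_smul, toU_comm, add_smul, mul_smul]
      exact add_mem (hQ _ (ih x)) (ih _)
    | zero =>
      have h0 : ∀ u ∈ vermaIdeal a c, u • vermaVec a c (0, 0) = 0 := by
        intro u hu
        simp only [vermaVec, pow_zero, one_smul]
        rw [← Submodule.Quotient.mk_smul, smul_eq_mul, mul_one]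
        exact (Submodule.Quotient.mk_eq_zero _).2 hu
      have hgen : ∀ u ∈ ({toU E, toU P, toU H - algebraMap ℂ U a, toU Z - algebraMap ℂ U c} : Set U),
          u • vermaVec a c (0, 0) = 0 := fun u hu => h0 u (Submodule.subset_span hu)
      have hE := hgen (toU E) (by simp)
      have hP := hgen (toU P) (by simp)
      have hH := hgen (toU H - algebraMap ℂ U a) (by simp)
      have hZ := hgen (toU Z - algebraMap ℂ U c) (by simp)
      rw [sub_smul, algebraMap_smul, sub_eq_zero] at hH hZ
      rw [eq_sum x]
      simp only [toU_add, Schrodinger.toU_smul, add_smul, smul_assoc, hE, hP, hH, hZ, smul_zero]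
      exact add_mem (add_mem (add_mem (add_mem (add_mem (zero_mem _)
        (Submodule.smul_mem _ _ (Submodule.smul_mem _ _ (mem _ _))))
        (Submodule.smul_mem _ _ (hF _ (mem _ _)))) (zero_mem _))
        (Submodule.smul_mem _ _ (hQ _ (mem _ _))))
        (Submodule.smul_mem _ _ (Submodule.smul_mem _ _ (mem _ _)))

lemma span_vermaVec (m : Verma a c) : m ∈ Submodule.span ℂ (Set.range (vermaVec a c)) := by
  obtain ⟨u, rfl⟩ := Submodule.Quotient.mk_surjective _ m
  have h1 : (Submodule.Quotient.mk u : Verma a c) = u • vermaVec a c (0, 0) := by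
    simp only [vermaVec, pow_zero, one_smul]
    rw [← Submodule.Quotient.mk_smul, smul_eq_mul, mul_one]
  rw [h1]
  refine smul_mem_of_toU_smul_mem (fun x m hm => ?_) u (Submodule.subset_span ⟨(0, 0), rfl⟩)
  refine Submodule.span_le (p := (Submodule.span ℂ (Set.range (vermaVec a c))).comap
    (Algebra.lsmul ℂ ℂ (Verma a c) (toU x))).2 ?_ hm
  rintro _ ⟨α, rfl⟩
  exact toU_smul_vermaVec_mem α x

/-- The spanning vectors `fᵏ qˡ v` go to distinct monomials. This gives the linear independence
usually taken from the Poincaré–Birkhoff–Witt theorem. -/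
lemma ofVerma_injective : Function.Injective (ofVerma a c) := by
  rw [injective_iff_map_eq_zero]
  intro m hm
  obtain ⟨b, rfl⟩ := Finsupp.mem_span_range_iff_exists_finsupp.1 (span_vermaVec m)
  refine Finset.sum_eq_zero fun α hα => ?_
  rw [Finsupp.sum, map_sum] at hm
  have h1 := congrArg (fun g : FormalSum a c => g α.1 α.2) hm
  simp only [sum_apply, LinearMap.map_smul_of_tower, ofVerma_vermaVec, smul_apply, mono_apply,
    zero_apply] at h1
  rw [Finset.sum_eq_single α] at h1
  · simp only [and_self, if_true, mul_one] at h1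
    simp only [h1, zero_smul]
  · intro β _ hβ
    rw [if_neg, mul_zero]
    rintro ⟨h2, h3⟩
    exact hβ (Prod.ext (by exact_mod_cast h2.symm) (by exact_mod_cast h3.symm))
  · intro h
    exact absurd hα h

/-! ### The localized Verma module inside the formal sums -/

open OreLocalization

namespace FormalSum

/-- Multiplication by an element of `powF`, as a permutation of the formal sums. -/
def powEquiv (s : powF) : FormalSum a c ≃ FormalSum a c := Equiv.ofBijective _ (bijective_smul s)

lemma smul_powEquiv_symm (s : powF) (g : FormalSum a c) : (s : U) • (powEquiv s).symm g = g :=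
  (powEquiv s).apply_symm_apply g

lemma eq_powEquiv_symm {s : powF} {g g' : FormalSum a c} (h : (s : U) • g = g') :
    g = (powEquiv s).symm g' := by
  rw [Equiv.eq_symm_apply]
  exact h

/-- The underlying function of `ofLocalized`. -/
def ofLocalizedFun : Localized (Verma a c) → FormalSum a c :=
  liftExpand (fun m s => (powEquiv s).symm (ofVerma a c m)) fun m t s hst => by
    refine eq_powEquiv_symm ?_
    rw [mul_smul, smul_powEquiv_symm, map_smul]

lemma smul_ofLocalizedFun (m : Verma a c) (s : powF) :
    (s : U) • ofLocalizedFun (m /ₒ s) = ofVerma a c m :=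
  smul_powEquiv_symm s _

lemma ofLocalizedFun_eq {m : Verma a c} {s : powF} {g : FormalSum a c}
    (h : (s : U) • g = ofVerma a c m) : ofLocalizedFun (m /ₒ s) = g :=
  (eq_powEquiv_symm h).symm

variable (a c) in
/-- The embedding of the localized Verma module in the formal sums. -/
def ofLocalized : Localized (Verma a c) →ₗ[U] FormalSum a c where
  toFun := ofLocalizedFun
  map_add' x y := by
    induction x using OreLocalization.ind with | _ m s
    induction y using OreLocalization.ind with | _ m' s'
    obtain ⟨r, t, hrt, h⟩ := oreDivAddChar' m m' s s'
    rw [h]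
    refine ofLocalizedFun_eq ?_
    rw [Submonoid.coe_mul, smul_add, mul_smul, smul_ofLocalizedFun, hrt, mul_smul,
      smul_ofLocalizedFun, map_add, Submonoid.smul_def, map_smul, map_smul]
  map_smul' u x := by
    induction x using OreLocalization.ind with | _ m s
    rw [RingHom.id_apply, smul_oreDiv]
    refine ofLocalizedFun_eq ?_
    rw [← mul_smul, smul_eq_mul, mul_one, ore_eq, mul_smul, smul_ofLocalizedFun, map_smul]

lemma smul_ofLocalized (m : Verma a c) (s : powF) :
    (s : U) • ofLocalized a c (m /ₒ s) = ofVerma a c m := smul_ofLocalizedFun m s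

lemma ofLocalized_canonicalMap (m : Verma a c) :
    ofLocalized a c (canonicalMap _ m) = ofVerma a c m :=
  ofLocalizedFun_eq (one_smul _ _)

lemma ofLocalized_injective : Function.Injective (ofLocalized a c) := by
  rw [injective_iff_map_eq_zero]
  intro x hx
  induction x using OreLocalization.ind with | _ m s
  have h := smul_ofLocalized m s
  rw [hx, smul_zero, eq_comm, map_eq_zero_iff _ ofVerma_injective] at h
  rw [h, zero_oreDiv]

variable (a c) in
/-- The finite formal sums with nonnegative powers of `q`. -/
def finite : Submodule ℂ (FormalSum a c) where
  carrier := {g | ∃ B : ℕ, ∀ i j : ℤ, g i j ≠ 0 → (-B ≤ i ∧ i ≤ B) ∧ 0 ≤ j ∧ j ≤ B}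
  add_mem' := by
    rintro g g' ⟨B, hB⟩ ⟨B', hB'⟩
    refine ⟨B + B', fun i j h => ?_⟩
    push_cast
    by_cases h0 : g i j = 0
    · have := hB' i j (by rwa [add_apply, h0, zero_add] at h)
      omega
    · have := hB i j h0
      omega
  zero_mem' := ⟨0, fun i j h => absurd rfl h⟩
  smul_mem' := by
    rintro t g ⟨B, hB⟩
    exact ⟨B, fun i j h => hB i j (right_ne_zero_of_mul h)⟩

lemma mono_mem_finite (k : ℤ) (l : ℕ) : (mono k l : FormalSum a c) ∈ finite a c := by
  refine ⟨k.natAbs + l, fun i j h => ?_⟩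
  rw [mono_apply] at h
  have h' : i = k ∧ j = l := by
    by_contra h0
    exact h (if_neg h0)
  rw [Nat.cast_add]
  omega

lemma ofVerma_mem_finite (m : Verma a c) :
    ofVerma a c m ∈ finite a c ∧ ∀ i j : ℤ, i < 0 → ofVerma a c m i j = 0 := by
  obtain ⟨b, rfl⟩ := Finsupp.mem_span_range_iff_exists_finsupp.1 (span_vermaVec m)
  simp only [Finsupp.sum, map_sum, LinearMap.map_smul_of_tower, ofVerma_vermaVec]
  refine ⟨Submodule.sum_mem _ fun α _ => Submodule.smul_mem _ _ (mono_mem_finite _ _), ?_⟩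
  intro i j hi
  rw [sum_apply]
  refine Finset.sum_eq_zero fun α _ => ?_
  rw [smul_apply, mono_apply, if_neg (by omega), mul_zero]

lemma exists_ofVerma_eq {g : FormalSum a c} (hg : g ∈ finite a c)
    (h : ∀ i j : ℤ, i < 0 → g i j = 0) : ∃ m, ofVerma a c m = g := by
  obtain ⟨B, hB⟩ := hg
  refine ⟨∑ α ∈ Finset.range (B + 1) ×ˢ Finset.range (B + 1),
    g α.1 α.2 • vermaVec a c α, ?_⟩
  ext i j
  simp only [map_sum, LinearMap.map_smul_of_tower, ofVerma_vermaVec, sum_apply, smul_apply,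
    mono_apply]
  by_cases h0 : g i j = 0
  · rw [h0]
    refine Finset.sum_eq_zero fun α _ => ?_
    split_ifs with h1
    · rw [← h1.1, ← h1.2, h0, zero_mul]
    · exact mul_zero _
  · have h1 := hB i j h0
    have h2 : 0 ≤ i := by
      by_contra h2
      exact h0 (h i j (by omega))
    lift i to ℕ using h2
    lift j to ℕ using h1.2.1
    rw [Finset.sum_eq_single (i, j)]
    · simp
    · rintro ⟨k, l⟩ _ hne
      rw [if_neg, mul_zero]
      rintro ⟨h2, h3⟩
      exact hne (Prod.ext (by exact_mod_cast h2.symm) (by exact_mod_cast h3.symm))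
    · intro h2
      refine absurd ?_ h2
      simp only [Finset.mem_product, Finset.mem_range]
      omega

lemma ofLocalized_mem_finite (x : Localized (Verma a c)) : ofLocalized a c x ∈ finite a c := by
  induction x using OreLocalization.ind with | _ m s
  obtain ⟨⟨B, hB⟩, -⟩ := ofVerma_mem_finite m
  have h := smul_ofLocalized m s
  obtain ⟨k, hk⟩ := s.2
  have hk' : toU F ^ k = (s : U) := hk
  rw [← hk'] at h
  refine ⟨B + k, fun i j hne => ?_⟩
  have := hB (i + k) j (by rwa [← h, F_pow_smul_apply, add_sub_cancel_right])
  push_cast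
  omega

lemma exists_ofLocalized_eq {g : FormalSum a c} (hg : g ∈ finite a c) :
    ∃ x, ofLocalized a c x = g := by
  obtain ⟨B, hB⟩ := hg
  -- Multiplying by `fᴮ` clears the negative powers of `f`.
  obtain ⟨m, hm⟩ := exists_ofVerma_eq (g := toU F ^ B • g) ⟨B + B, fun i j h => by
      rw [F_pow_smul_apply] at h
      have := hB _ _ h
      push_cast
      omega⟩ (fun i j hi => by
      rw [F_pow_smul_apply]
      by_contra h
      have := hB _ _ h
      omega)
  exact ⟨m /ₒ ⟨toU F ^ B, B, rfl⟩, ofLocalizedFun_eq hm.symm⟩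

end FormalSum

/-- An element of the localized Verma module vanishes in the quotient if and only if it has no
coefficients at negative powers of `f`. -/
lemma twist_mk_eq_zero_iff (x : Localized (Verma a c)) :
    (Submodule.Quotient.mk x : Twist (Verma a c)) = 0 ↔
      ∀ i j : ℤ, i < 0 → ofLocalized a c x i j = 0 := by
  rw [Submodule.Quotient.mk_eq_zero]
  constructor
  · rintro ⟨m, rfl⟩ i j hi
    rw [ofLocalized_canonicalMap]
    exact (ofVerma_mem_finite m).2 i j hi
  · intro h
    obtain ⟨m, hm⟩ := exists_ofVerma_eq (ofLocalized_mem_finite x) h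
    exact ⟨m, ofLocalized_injective (by rw [ofLocalized_canonicalMap, hm])⟩

/-! ### Coefficients and singular vectors in the completion -/

namespace EA

section
variable (M : Type*) [AddCommGroup M] [Module U M] [Module ℂ M] [IsScalarTower ℂ U M]

/-- The inclusion of the completion in `S_f ⊗ M`. -/
def val : EA M →ₗ[U] Twist M := (eFinite (Twist M)).subtype

variable {M}

lemma val_injective : Function.Injective (val M) := Subtype.val_injective

lemma exists_val_eq {x : Twist M} (hx : x ∈ eFinite (Twist M)) : ∃ y, val M y = x :=
  ⟨(⟨x, hx⟩ : eFinite (Twist M)), rfl⟩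

lemma val_lie (x : Schrodinger) (m : EA M) : val M ⁅x, m⁆ = toU x • val M m := rfl

lemma val_smul (t : ℂ) (m : EA M) : val M (t • m) = t • val M m := rfl

lemma val_pw (x : Schrodinger) (k : ℕ) (m : EA M) : val M (pw x k m) = toU x ^ k • val M m := by
  induction k with
  | zero => simp
  | succ k ih => rw [pw_succ, val_lie, ih, pow_succ', mul_smul]

/-- The vectors `eᵏ x` have distinct weights and span a finite-dimensional space. -/
lemma exists_pw_E_eq_zero {x : EA M} {μ : ℂ} (hx : ⁅H, x⁆ = μ • x) : ∃ k, pw E k x = 0 := by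
  have hfd : FiniteDimensional ℂ
      (Submodule.span ℂ (Set.range fun k : ℕ => toU E ^ k • val M x)) := x.2
  obtain ⟨k, hk⟩ := exists_pow_eq_zero (Algebra.lsmul ℂ ℂ (Twist M) (toU H)) _
    (y := fun k => val M (pw E k x)) (μ := μ) (d := 2)
    (fun j => Submodule.subset_span (Set.mem_range.2 ⟨j, (val_pw E j x).symm⟩)) two_ne_zero
    (fun j => congrArg (val M) (H_pw_E hx j))
  exact ⟨k, val_injective (hk.trans (map_zero _).symm)⟩

end

/-- The class of an element of the localized Verma module. -/
def mk : Localized (Verma a c) →ₗ[U] Twist (Verma a c) := Submodule.mkQ _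

lemma mk_surjective : Function.Surjective (mk (a := a) (c := c)) := Submodule.mkQ_surjective _

lemma mk_eq_zero_iff (y : Localized (Verma a c)) :
    mk y = 0 ↔ ∀ i j : ℤ, i < 0 → ofLocalized a c y i j = 0 := twist_mk_eq_zero_iff y

/-- Reduces identities in the completion to identities between coefficients at negative powers of
`f`. -/
lemma eq_zero_iff {x : EA (Verma a c)} {y : Localized (Verma a c)} (h : mk y = val _ x) :
    x = 0 ↔ ∀ i j : ℤ, i < 0 → ofLocalized a c y i j = 0 := by
  rw [← mk_eq_zero_iff, h, map_eq_zero_iff _ val_injective]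

lemma isSingular_iff {x : EA (Verma a c)} {y : Localized (Verma a c)} (h : mk y = val _ x)
    (m : ℂ) : IsSingular x m ↔
      (∀ i j : ℤ, i < 0 → (toU E • ofLocalized a c y) i j = 0) ∧
      ∀ i j : ℤ, i < 0 → (a - 2 * i - j - m) * ofLocalized a c y i j = 0 := by
  have h1 : ⁅E, x⁆ = 0 ↔ ∀ i j : ℤ, i < 0 → (toU E • ofLocalized a c y) i j = 0 := by
    rw [← map_smul]
    exact eq_zero_iff (by rw [map_smul, h, val_lie])
  have h2 : ⁅H, x⁆ = m • x ↔
      ∀ i j : ℤ, i < 0 → (a - 2 * i - j - m) * ofLocalized a c y i j = 0 := by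
    rw [← sub_eq_zero, eq_zero_iff (y := toU H • y - m • y)
      (by rw [map_sub, map_sub, map_smul, val_lie, val_smul, LinearMap.map_smul_of_tower, h])]
    simp only [map_sub, map_smul, LinearMap.map_smul_of_tower, sub_apply, H_smul_apply, smul_apply,
      sub_mul _ m]
  rw [← h1, ← h2]
  exact ⟨fun h => ⟨h.e, h.h⟩, fun h => ⟨h.1, h.2⟩⟩

lemma lower_eq_zero_iff {x : EA (Verma a c)} {y : Localized (Verma a c)} (h : mk y = val _ x)
    (m : ℂ) : lower m x = 0 ↔ ∀ i j : ℤ, i < 0 →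
      (m + i + 1) * ofLocalized a c y i (j - 1) - c * (j + 1) * ofLocalized a c y (i - 1) (j + 1)
        = 0 := by
  rw [eq_zero_iff (y := m • toU Q • y - toU P • toU F • y) (by
    rw [lower, map_sub, map_sub, val_smul, val_lie, val_lie, val_lie, LinearMap.map_smul_of_tower,
      map_smul, map_smul, map_smul, h])]
  refine forall_congr' fun i => forall_congr' fun j => imp_congr_right fun _ => ?_
  rw [map_sub, LinearMap.map_smul_of_tower, map_smul, map_smul, map_smul, sub_apply, smul_apply,
    Q_smul_apply, P_smul_apply, F_smul_apply, F_smul_apply, add_sub_cancel_right]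
  refine Eq.congr_left ?_
  ring

/-- A high power of `f` clears the denominator, so the class lands in the image of the Verma module.
-/
lemma pw_F_nilpotent (x : EA (Verma a c)) : ∃ k, pw F k x = 0 := by
  obtain ⟨y, hy⟩ := mk_surjective (val _ x)
  obtain ⟨B, hB⟩ := ofLocalized_mem_finite y
  refine ⟨B, (eq_zero_iff (y := toU F ^ B • y) (by rw [map_smul, hy, val_pw])).2 fun i j hi => ?_⟩
  rw [map_smul, F_pow_smul_apply]
  by_contra h
  have := hB _ _ h
  omega

lemma hasCentralCharge : HasCentralCharge (EA (Verma a c)) c := by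
  intro x
  obtain ⟨y, hy⟩ := mk_surjective (val _ x)
  rw [← sub_eq_zero, eq_zero_iff (y := toU Z • y - c • y)
    (by rw [map_sub, map_sub, map_smul, val_lie, val_smul, LinearMap.map_smul_of_tower, hy])]
  intro i j _
  rw [map_sub, map_smul, LinearMap.map_smul_of_tower, sub_apply, Z_smul_apply, smul_apply, sub_self]

lemma span_weight_eq_top : Submodule.span ℂ
    {x : EA (Verma a c) | (∃ μ : ℂ, ⁅H, x⁆ = μ • x) ∧ ∃ k, pw E k x = 0} = ⊤ := by
  rw [eq_top_iff]
  intro x _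
  obtain ⟨y, hy⟩ := mk_surjective (val _ x)
  obtain ⟨B, hB⟩ := ofLocalized_mem_finite y
  -- The component of weight `a + w`.
  have hex : ∀ w : ℤ, ∃ z : Localized (Verma a c), ofLocalized a c z =
      (fun i j => if -2 * i - j = w then ofLocalized a c y i j else 0 : FormalSum a c) := by
    intro w
    refine exists_ofLocalized_eq ⟨B, fun i j h => hB i j ?_⟩
    dsimp only at h
    split_ifs at h with h1
    · exact h
    · exact absurd rfl h
  choose z hz using hex
  have hsum : y = ∑ w ∈ Finset.Icc (-3 * B : ℤ) (3 * B), z w := by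
    refine ofLocalized_injective ?_
    ext i j
    rw [map_sum, sum_apply]
    simp only [hz]
    rw [Finset.sum_ite_eq]
    split_ifs with h
    · rfl
    · by_contra h0
      have := hB i j h0
      rw [Finset.mem_Icc] at h
      omega
  have hH : ∀ w, toU H • z w = (a + w) • z w := by
    intro w
    refine ofLocalized_injective ?_
    ext i j
    rw [map_smul, LinearMap.map_smul_of_tower, H_smul_apply, smul_apply, hz]
    dsimp only
    split_ifs with h
    · rw [← h]; push_cast; ring
    · simp
  -- The `e`-finite part is stable under `h`, hence contains every weight component of its elements.
  have hmem := mem_of_sum_mem (A := Algebra.lsmul ℂ ℂ (Twist (Verma a c)) (toU H))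
    (X := (eFinite (Twist (Verma a c))).restrictScalars ℂ)
    (fun x hx => (eFinite (Twist (Verma a c))).smul_mem (toU H) hx)
    (l := fun w : ℤ => a + w) (Finset.Icc (-3 * B : ℤ) (3 * B))
    (fun w _ w' _ h => by simpa using h) (fun w => mk (z w))
    (fun w _ => (map_smul mk (toU H) (z w)).symm.trans
      ((congrArg mk (hH w)).trans (LinearMap.map_smul_of_tower mk _ _)))
    (by rw [← map_sum, ← hsum, hy]; exact x.2)
  have hx : val _ x ∈ (Submodule.span ℂ
      {x : EA (Verma a c) | (∃ μ : ℂ, ⁅H, x⁆ = μ • x) ∧ ∃ k, pw E k x = 0}).map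
      ((val (Verma a c)).restrictScalars ℂ) := by
    rw [← hy, hsum, map_sum]
    refine Submodule.sum_mem _ fun w hw => ?_
    obtain ⟨t, ht⟩ := exists_val_eq (hmem w hw)
    have hHt : ⁅H, t⁆ = (a + w) • t := by
      refine val_injective ?_
      rw [val_lie, val_smul, ht, ← map_smul, hH, LinearMap.map_smul_of_tower]
    exact ⟨t, Submodule.subset_span ⟨⟨_, hHt⟩, exists_pw_E_eq_zero hHt⟩, ht⟩
  obtain ⟨x', hx', h⟩ := hx
  exact val_injective h ▸ hx'

/-- A coefficient sequence annihilated by `e`, of weight `m`, is determined by one entry. -/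
lemma exists_determining (hc : c ≠ 0) (a m : ℤ) : ∃ i₀ j₀ : ℤ, ∀ g : FormalSum (a : ℂ) c,
    g ∈ finite (a : ℂ) c → (∀ i j : ℤ, i < 0 → (toU E • g) i j = 0) →
    (∀ i j : ℤ, i < 0 → ((a : ℂ) - 2 * i - j - m) * g i j = 0) → g i₀ j₀ = 0 →
    ∀ i j : ℤ, i < 0 → g i j = 0 := by
  -- Weight `m` confines the support to the points `(-1 - s, a + 2 + 2s - m)`; `s₀` is the first `s
  -- ≥ 0` at which the exponent of `q` is nonnegative.
  let s₀ : ℕ := ((m - a - 1) / 2).toNat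
  refine ⟨-1 - s₀, a + 2 + 2 * s₀ - m, fun g hg hE hH h0 => ?_⟩
  obtain ⟨B, hB⟩ := hg
  have key : ∀ s : ℕ, g (-1 - s) (a + 2 + 2 * s - m) = 0 := by
    intro s
    induction s with
    | zero =>
      rcases Nat.eq_zero_or_pos s₀ with h | h
      · rw [h] at h0; exact h0
      · by_contra hne
        have := hB _ _ hne
        omega
    | succ t ih =>
      rcases lt_trichotomy (t + 1) s₀ with h | h | h
      · by_contra hne
        have := hB _ _ hne
        omega
      · rw [h]; exact h0
      · have h1 := hE (-1 - (t + 1 : ℕ)) (a + 2 * (t + 1 : ℕ) - m) (by omega)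
        rw [E_smul_apply, show (-1 - ((t + 1 : ℕ) : ℤ) + 1 : ℤ) = -1 - (t : ℤ) by push_cast; ring,
          show (a + 2 * ((t + 1 : ℕ) : ℤ) - m : ℤ) = a + 2 + 2 * t - m by push_cast; ring, ih,
          mul_zero, zero_add] at h1
        rw [show (a + 2 + 2 * ((t + 1 : ℕ) : ℤ) - m : ℤ) = a + 2 + 2 * t - m + 2 by push_cast; ring]
        refine (mul_eq_zero.1 h1).resolve_left (mul_ne_zero hc (div_ne_zero ?_ two_ne_zero))
        have h2 : 0 ≤ a + 2 + 2 * (t : ℤ) - m := by omega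
        refine mul_ne_zero ?_ ?_ <;> norm_cast <;> omega
  intro i j hi
  by_contra hne
  have h1 := (mul_eq_zero.1 (hH i j hi)).resolve_right hne
  have h2 : a - 2 * i - j - m = 0 := by exact_mod_cast h1
  have h3 := key (-1 - i).toNat
  rw [show -1 - (((-1 - i).toNat : ℕ) : ℤ) = i by omega,
    show a + 2 + 2 * (((-1 - i).toNat : ℕ) : ℤ) - m = j by omega] at h3
  exact hne h3

lemma singular_unique (hc : c ≠ 0) (a : ℤ) (m : ℕ) {x x' : EA (Verma (a : ℂ) c)}
    (hx : IsSingular x m) (hx' : IsSingular x' m) (h0 : x ≠ 0) : ∃ t : ℂ, x' = t • x := by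
  obtain ⟨i₀, j₀, hdet⟩ := exists_determining hc a m
  have hsing : ∀ {w : EA (Verma (a : ℂ) c)} {y}, mk y = val _ w → IsSingular w m →
      ofLocalized _ c y i₀ j₀ = 0 → w = 0 := by
    intro w y hy hw h
    have hw' := (isSingular_iff hy m).1 hw
    exact (eq_zero_iff hy).2 (hdet _ (ofLocalized_mem_finite y) hw'.1
      (by simpa using hw'.2) h)
  obtain ⟨y, hy⟩ := mk_surjective (val _ x)
  obtain ⟨y', hy'⟩ := mk_surjective (val _ x')
  have hne : ofLocalized _ c y i₀ j₀ ≠ 0 := fun h => h0 (hsing hy hx h)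
  refine ⟨ofLocalized _ c y' i₀ j₀ / ofLocalized _ c y i₀ j₀, ?_⟩
  rw [← sub_eq_zero]
  refine hsing (y := y' - (ofLocalized _ c y' i₀ j₀ / ofLocalized _ c y i₀ j₀) • y) ?_ ?_ ?_
  · rw [map_sub, map_sub, LinearMap.map_smul_of_tower, val_smul, hy, hy']
  · exact (singular _ m).sub_mem hx' ((singular _ m).smul_mem _ hx)
  · rw [map_sub, LinearMap.map_smul_of_tower, sub_apply, smul_apply, div_mul_cancel₀ _ hne, sub_self]

/-- The class of `g` is killed by `e`, hence is `e`-finite and lies in the completion. -/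
lemma exists_isBottom_of_finite {g : FormalSum a c} (hg : g ∈ finite a c) {n : ℕ}
    (hE : ∀ i j : ℤ, i < 0 → (toU E • g) i j = 0)
    (hH : ∀ i j : ℤ, i < 0 → (a - 2 * i - j - n) * g i j = 0)
    (hl : ∀ i j : ℤ, i < 0 → ((n : ℂ) + i + 1) * g i (j - 1) - c * (j + 1) * g (i - 1) (j + 1) = 0)
    (h0 : ∃ i j : ℤ, i < 0 ∧ g i j ≠ 0) : ∃ v : EA (Verma a c), IsBottom v n c := by
  obtain ⟨y, rfl⟩ := exists_ofLocalized_eq hg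
  have hEy : toU E • mk y = 0 := by
    rw [← map_smul, mk_eq_zero_iff, map_smul]
    exact hE
  have hmem : mk y ∈ eFinite (Twist (Verma a c)) := by
    refine Submodule.finiteDimensional_of_le (S₂ := Submodule.span ℂ {mk y}) ?_
    rw [Submodule.span_le]
    rintro _ ⟨k, rfl⟩
    rcases k with _ | k
    · simp
    · simp only [pow_succ, mul_smul, hEy, smul_zero]
      exact zero_mem _
  obtain ⟨v, hv⟩ := exists_val_eq hmem
  refine ⟨v, fun h => ?_, (isSingular_iff hv.symm n).2 ⟨hE, hH⟩, (lower_eq_zero_iff hv.symm n).2 hl,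
    hasCentralCharge, pw_F_nilpotent⟩
  obtain ⟨i, j, hi, hne⟩ := h0
  exact hne ((eq_zero_iff hv.symm).1 h i j hi)

/-- The nonzero coefficients of the vector of minimal type in the completion of a Verma module
of highest weight `n - 1`. -/
def bottomCoeff (n : ℕ) (c : ℂ) : ℕ → ℂ
  | 0 => 1
  | s + 1 => ((n : ℂ) - s) / (c * (2 * s + 3)) * bottomCoeff n c s

lemma bottomCoeff_succ (hc : c ≠ 0) (n s : ℕ) :
    c * (2 * s + 3) * bottomCoeff n c (s + 1) = ((n : ℂ) - s) * bottomCoeff n c s := by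
  have h : (2 * s + 3 : ℂ) ≠ 0 := by norm_cast
  rw [bottomCoeff]
  field_simp

/-- The factor `n - s` vanishes at `s = n`; this is what makes the bottom vector a finite sum. -/
lemma bottomCoeff_eq_zero (c : ℂ) {n s : ℕ} (h : n < s) : bottomCoeff n c s = 0 := by
  induction s with
  | zero => omega
  | succ s ih =>
    rw [bottomCoeff]
    rcases (Nat.lt_succ_iff.1 h).eq_or_lt with rfl | h
    · simp
    · rw [ih h, mul_zero]

lemma exists_isBottom_sub_one (hc : c ≠ 0) (n : ℕ) :
    ∃ v : EA (Verma ((n : ℂ) - 1) c), IsBottom v n c := by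
  -- This is `∑ bₛ f⁻¹⁻ˢ q²ˢ⁺¹ v`, whose terms have weight `n`. Vanishing under the lowering
  -- operator is exactly the recursion for `bₛ`, and vanishing under `e` is `s + 1` times it.
  let g : FormalSum ((n : ℂ) - 1) c := fun i j =>
    if i < 0 ∧ j = -2 * i - 1 then bottomCoeff n c (-1 - i).toNat else 0
  have hg : ∀ i j, g i j = if i < 0 ∧ j = -2 * i - 1 then bottomCoeff n c (-1 - i).toNat else 0 :=
    fun _ _ => rfl
  have hsupp : ∀ i j, g i j ≠ 0 → i < 0 ∧ j = -2 * i - 1 ∧ (-1 - i).toNat ≤ n := by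
    intro i j h
    rw [hg] at h
    split_ifs at h with h1
    · refine ⟨h1.1, h1.2, ?_⟩
      by_contra h2
      exact h (bottomCoeff_eq_zero c (by omega))
    · exact absurd rfl h
  have hs : ∀ (s : ℕ) (i j : ℤ), i = -1 - s → j = 2 * s + 1 → g i j = bottomCoeff n c s := by
    rintro s i j rfl rfl
    rw [hg, if_pos (by omega)]
    congr 1
    omega
  refine exists_isBottom_of_finite (g := g) ⟨2 * n + 2, fun i j h => ?_⟩ (fun i j hi => ?_)
    (fun i j hi => ?_) (fun i j hi => ?_) ⟨-1, 1, by norm_num, ?_⟩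
  · have := hsupp i j h
    push_cast
    omega
  · rw [E_smul_apply]
    by_cases hj : j = -2 * i - 3
    · obtain ⟨s, rfl⟩ : ∃ s : ℕ, i = -1 - s := ⟨(-1 - i).toNat, by omega⟩
      subst hj
      rcases s with _ | s
      · simp only [hg]
        simp
      · rw [hs s _ _ (by push_cast; ring) (by push_cast; ring),
          hs (s + 1) _ _ rfl (by push_cast; ring)]
        have := bottomCoeff_succ hc n s
        push_cast
        linear_combination ((s : ℂ) + 1) * this
    · rw [hg, hg, if_neg (by omega), if_neg (by omega)]
      simp
  · by_cases h : g i j = 0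
    · rw [h, mul_zero]
    · have := hsupp i j h
      rw [this.2.1]
      push_cast
      ring
  · by_cases hj : j = -2 * i
    · obtain ⟨s, rfl⟩ : ∃ s : ℕ, i = -1 - s := ⟨(-1 - i).toNat, by omega⟩
      subst hj
      rw [hs s _ _ rfl (by ring), hs (s + 1) _ _ (by push_cast; ring) (by push_cast; ring)]
      have := bottomCoeff_succ hc n s
      push_cast
      linear_combination -this
    · rw [hg, hg, if_neg (by omega), if_neg (by omega)]
      simp
  · rw [hs 0 _ _ (by simp) (by simp), bottomCoeff]
    exact one_ne_zero

lemma exists_isBottom_neg (c : ℂ) (n : ℕ) :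
    ∃ v : EA (Verma (-(n : ℂ) - 2) c), IsBottom v n c := by
  -- The vector `f⁻ⁿ⁻¹ v` has weight `-n - 2 + 2(n + 1) = n`.
  refine exists_isBottom_of_finite (g := mono (-(n + 1)) 0) (by
    simpa using mono_mem_finite (-((n : ℤ) + 1)) 0) (fun i j hi => ?_)
    (fun i j hi => ?_) (fun i j hi => ?_) ⟨-(n + 1), 0, by omega, by simp [mono_apply]⟩
  · rw [E_smul_apply, mono_apply, mono_apply]
    split_ifs with h1 h2 h2
    · omega
    · have h3 : (i : ℂ) = -n - 2 := by
        have : i = -n - 2 := by omega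
        rw [this]; push_cast; ring
      rw [h3, h1.2]; push_cast; ring
    · have h : (j : ℂ) + 2 = 0 := by exact_mod_cast h2.2
      simp [h]
    · simp
  · rw [mono_apply]
    split_ifs with h
    · rw [h.1, h.2]; push_cast; ring
    · simp
  · rw [mono_apply, mono_apply]
    split_ifs with h1 h2 h2
    · omega
    · rw [h1.1]; push_cast; ring
    · have h : (j : ℂ) + 1 = 0 := by exact_mod_cast h2.2
      simp [h]
    · simp

lemma exists_isBottom_span_eq_top (hc : c ≠ 0) {n : ℕ} (ha : a = (n : ℂ) - 1 ∨ a = -(n : ℂ) - 2) :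
    ∃ (v : EA (Verma a c)) (hv : IsBottom v n c), hv.span = ⊤ := by
  obtain ⟨v, hv⟩ : ∃ v : EA (Verma a c), IsBottom v n c := by
    rcases ha with rfl | rfl
    · exact exists_isBottom_sub_one hc n
    · exact exists_isBottom_neg c n
  obtain ⟨a', rfl⟩ : ∃ a' : ℤ, a = a' := by
    rcases ha with rfl | rfl
    · exact ⟨n - 1, by push_cast; rfl⟩
    · exact ⟨-n - 2, by push_cast; rfl⟩
  exact ⟨v, hv, hv.span_eq_top_of_singular hc span_weight_eq_top
    fun m x y hx hy h0 => singular_unique hc a' m hx hy h0⟩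

end EA

/-! ### The classification -/

/-- `V(n, c)` and `V(-n, c)` are generated by a vector of weight `n`. -/
lemma exists_isBottom_V {c : ℂ} (hc : c ≠ 0) {k : ℤ} {n : ℕ} (hk : k = n ∨ k = -n) :
    ∃ (v : V k c) (hv : IsBottom v n c), hv.span = ⊤ := by
  refine EA.exists_isBottom_span_eq_top hc ?_
  split_ifs with h
  · obtain rfl : k = n := by omega
    exact Or.inl (by push_cast; rfl)
  · obtain rfl : k = -n := by omega
    exact Or.inr (by push_cast; rfl)

/-- A simple Harish-Chandra module of nonzero central charge is isomorphic to any module generated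
by a vector of the same weight and central charge. -/
lemma IsHarishChandra.nonempty_equiv {M : Type*} [AddCommGroup M] [Module ℂ M]
    [LieRingModule Schrodinger M] [LieModule ℂ Schrodinger M]
    (hM : LieModule.IsIrreducible ℂ Schrodinger M) (h : IsHarishChandra M) {n : ℕ} {c : ℂ}
    (hc : c ≠ 0) (hMc : HasCentralCharge M c) (hn : IsMinimalType M n) {k : ℤ}
    (hk : k = n ∨ k = -n) : Nonempty (M ≃ₗ⁅ℂ, Schrodinger⁆ V k c) := by
  obtain ⟨v, hv⟩ := h.exists_isBottom hn hMc
  obtain ⟨w, hw, hwt⟩ := exists_isBottom_V hc hk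
  exact hv.nonempty_equiv hc (hv.span_eq_top hM) hw hwt

lemma nonempty_V_equiv_V_neg (n : ℕ) {c : ℂ} (hc : c ≠ 0) :
    Nonempty (V n c ≃ₗ⁅ℂ, Schrodinger⁆ V (-n) c) := by
  obtain ⟨v, hv, hvt⟩ := exists_isBottom_V hc (k := n) (Or.inl rfl)
  obtain ⟨w, hw, hwt⟩ := exists_isBottom_V hc (k := -n) (Or.inr rfl)
  exact hv.nonempty_equiv hc hvt hw hwt

lemma HasCentralCharge.of_equiv {M N : Type*} [AddCommGroup M] [Module ℂ M]
    [LieRingModule Schrodinger M] [LieModule ℂ Schrodinger M] [AddCommGroup N] [Module ℂ N]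
    [LieRingModule Schrodinger N] [LieModule ℂ Schrodinger N] (f : M ≃ₗ⁅ℂ, Schrodinger⁆ N) {c : ℂ}
    (h : HasCentralCharge N c) : HasCentralCharge M c := by
  intro x
  refine f.injective ?_
  exact (LieModuleHom.map_lie f.toLieModuleHom Z x).trans
    ((h (f x)).trans (map_smul f.toLieModuleHom c x).symm)

lemma IsBottom.weight_le_of_equiv {M N : Type*} [AddCommGroup M] [Module ℂ M]
    [LieRingModule Schrodinger M] [LieModule ℂ Schrodinger M] [AddCommGroup N] [Module ℂ N]
    [LieRingModule Schrodinger N] [LieModule ℂ Schrodinger N] (f : M ≃ₗ⁅ℂ, Schrodinger⁆ N)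
    {n : ℕ} {c : ℂ} {v : M} (hv : IsBottom v n c) {w : N} {n' : ℕ} {c' : ℂ} (hw : IsBottom w n' c')
    (hwt : hw.span = ⊤) : n' ≤ n := by
  have hfv : f v ≠ 0 := fun h => hv.ne_zero (f.injective (h.trans (map_zero f.toLieModuleHom).symm))
  refine hw.le_of_isSingular hwt hfv ⟨?_, ?_⟩
  · exact (LieModuleHom.map_lie f.toLieModuleHom E v).symm.trans
      ((congrArg f hv.singular.e).trans (map_zero f.toLieModuleHom))
  · exact (LieModuleHom.map_lie f.toLieModuleHom H v).symm.trans
      ((congrArg f hv.singular.h).trans (map_smul f.toLieModuleHom (n : ℂ) v))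

lemma L.hasCentralCharge (n : ℕ) : HasCentralCharge (L n) 0 := by
  intro x
  ext k hk
  rw [L.coord_lie _ _ _ hk]
  simp [Z]

end Schrodinger

end

open Schrodinger in
theorem theorem5p14 :
    -- the classification by central charge and minimal type
    (∀ (M : Type u) [AddCommGroup M] [Module ℂ M] [LieRingModule Schrodinger M]
        [LieModule ℂ Schrodinger M],
      LieModule.IsIrreducible ℂ Schrodinger M → IsHarishChandra M →
        (∃! c : ℂ, HasCentralCharge M c) ∧ (∃! n : ℕ, IsMinimalType M n) ∧
        ∀ (c : ℂ) (n : ℕ), HasCentralCharge M c → IsMinimalType M n →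
          (c ≠ 0 →
            Nonempty (M ≃ₗ⁅ℂ, Schrodinger⁆ V n c) ∧
            Nonempty (M ≃ₗ⁅ℂ, Schrodinger⁆ V (-n) c) ∧
            Nonempty (V n c ≃ₗ⁅ℂ, Schrodinger⁆ V (-n) c)) ∧
          (c = 0 → Nonempty (M ≃ₗ⁅ℂ, Schrodinger⁆ L n))) ∧
    -- the two completions defining `V(0, c)` agree, and `V(n, c) ≅ V(-n, c)`
    (∀ c : ℂ, c ≠ 0 → Nonempty (V 0 c ≃ₗ⁅ℂ, Schrodinger⁆ EA (Verma (-2) c))) ∧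
    (∀ (n : ℕ) (c : ℂ), c ≠ 0 → Nonempty (V n c ≃ₗ⁅ℂ, Schrodinger⁆ V (-n) c)) ∧
    -- the modules in the list are simple Harish-Chandra modules
    (∀ (n : ℕ) (c : ℂ), c ≠ 0 →
      LieModule.IsIrreducible ℂ Schrodinger (V n c) ∧ IsHarishChandra (V n c) ∧
      HasCentralCharge (V n c) c ∧ IsMinimalType (V n c) n) ∧
    (∀ n : ℕ, LieModule.IsIrreducible ℂ Schrodinger (L n) ∧ IsHarishChandra (L n)) ∧
    -- the list is complete
    (∀ (M : Type u) [AddCommGroup M] [Module ℂ M] [LieRingModule Schrodinger M]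
        [LieModule ℂ Schrodinger M],
      LieModule.IsIrreducible ℂ Schrodinger M → IsHarishChandra M →
        (∃ (n : ℕ) (c : ℂ), c ≠ 0 ∧ Nonempty (M ≃ₗ⁅ℂ, Schrodinger⁆ V n c)) ∨
        (∃ n : ℕ, Nonempty (M ≃ₗ⁅ℂ, Schrodinger⁆ L n))) ∧
    -- the list is irredundant
    (∀ (n n' : ℕ) (c c' : ℂ), c ≠ 0 → c' ≠ 0 →
      Nonempty (V n c ≃ₗ⁅ℂ, Schrodinger⁆ V n' c') → n = n' ∧ c = c') ∧
    (∀ n n' : ℕ, Nonempty (L n ≃ₗ⁅ℂ, Schrodinger⁆ L n') → n = n') ∧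
    (∀ (n n' : ℕ) (c : ℂ), c ≠ 0 → ¬ Nonempty (V n c ≃ₗ⁅ℂ, Schrodinger⁆ L n')) := by
  have hbV : ∀ (n : ℕ) {c : ℂ}, c ≠ 0 → ∃ (v : V n c) (hv : IsBottom v n c), hv.span = ⊤ :=
    fun n c hc => exists_isBottom_V hc (Or.inl rfl)
  have hchar : ∀ (M : Type u) [AddCommGroup M] [Module ℂ M] [LieRingModule Schrodinger M]
      [LieModule ℂ Schrodinger M], LieModule.IsIrreducible ℂ Schrodinger M → IsHarishChandra M →
      ∀ (c : ℂ) (n : ℕ), HasCentralCharge M c → IsMinimalType M n →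
        c = 0 → Nonempty (M ≃ₗ⁅ℂ, Schrodinger⁆ L n) := by
    rintro M _ _ _ _ hM h c n hc hn rfl
    obtain ⟨v, hv⟩ := h.exists_isBottom hn hc
    exact hv.nonempty_equiv_L hM
  refine ⟨fun M _ _ _ _ hM h => ?_, fun c hc => ?_, fun n c hc => nonempty_V_equiv_V_neg n hc,
    fun n c hc => ?_, fun n => ⟨L.isIrreducible n, L.isHarishChandra n⟩, fun M _ _ _ _ hM h => ?_,
    fun n n' c c' hc hc' => ?_, fun n n' => ?_, fun n n' c hc => ?_⟩
  · have : Nontrivial M := LieModule.nontrivial_of_isIrreducible ℂ Schrodinger M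
    obtain ⟨c, hc⟩ := h.exists_hasCentralCharge hM
    obtain ⟨n, hn⟩ := h.exists_isMinimalType
    refine ⟨⟨c, hc, fun c' hc' => hc'.unique hc⟩, ⟨n, hn, fun n' hn' => hn'.unique hn⟩,
      fun c n hc hn => ⟨fun h0 => ⟨h.nonempty_equiv hM h0 hc hn (Or.inl rfl),
        h.nonempty_equiv hM h0 hc hn (Or.inr rfl), nonempty_V_equiv_V_neg n h0⟩,
        hchar M hM h c n hc hn⟩⟩
  · obtain ⟨v, hv, hvt⟩ := exists_isBottom_V hc (k := 0) (n := 0) (Or.inl rfl)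
    -- The highest weight `-2` is `-n - 2` for `n = 0`.
    obtain ⟨w, hw, hwt⟩ := EA.exists_isBottom_span_eq_top (a := -2) hc (n := 0) (Or.inr (by simp))
    exact hv.nonempty_equiv hc hvt hw hwt
  · obtain ⟨v, hv, hvt⟩ := hbV n hc
    exact ⟨hv.isIrreducible hc hvt, hv.isHarishChandra hc hvt, hv.charge, hv.isMinimalType hvt⟩
  · have : Nontrivial M := LieModule.nontrivial_of_isIrreducible ℂ Schrodinger M
    obtain ⟨c, hc⟩ := h.exists_hasCentralCharge hM
    obtain ⟨n, hn⟩ := h.exists_isMinimalType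
    by_cases h0 : c = 0
    · exact Or.inr ⟨n, hchar M hM h c n hc hn h0⟩
    · exact Or.inl ⟨n, c, h0, h.nonempty_equiv hM h0 hc hn (Or.inl rfl)⟩
  · rintro ⟨f⟩
    obtain ⟨v, hv, hvt⟩ := hbV n hc
    obtain ⟨w, hw, hwt⟩ := hbV n' hc'
    have : Nontrivial (V n c) := ⟨v, 0, hv.ne_zero⟩
    exact ⟨le_antisymm (IsBottom.weight_le_of_equiv f.symm hw hv hvt)
      (IsBottom.weight_le_of_equiv f hv hw hwt), hv.charge.unique (hw.charge.of_equiv f)⟩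
  · rintro ⟨f⟩
    have := f.toLinearEquiv.finrank_eq
    rw [L.finrank, L.finrank] at this
    omega
  · rintro ⟨f⟩
    obtain ⟨v, hv, -⟩ := hbV n hc
    have : Nontrivial (V n c) := ⟨v, 0, hv.ne_zero⟩
    -- The two lists are separated by the central charge, which is zero on `L(n')`.
    exact hc (hv.charge.unique ((L.hasCentralCharge n').of_equiv f))
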